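/- For $t=(t_0,t_1,t_2,t_3)\in\mathbb C^4$ let $\Delta(t)=t_0(27t_0t_3^2-t_2^3)$, let $T=\{t\in\mathbb C^4\mid\Delta(t)\neq 0\}$, and for $t\in T$ let $E_t\subset\mathbb C^2$ be the curve $y^2=4t_0(x-t_1)^3-t_2(x-t_1)-t_3$ with the differential forms $\omega_1=\frac{dx}{y}$, $\omega_2=\frac{x\,dx}{y}$. Let $U\subset T$ be open and let $\delta_1=\delta_{1,t}$, $\delta_2=\delta_{2,t}$, $t\in U$, be two continuous families of cycles in $E_t$, each represented by closed $C^1$ paths in $E_t$ depending continuously on $t$ (for instance, families forming a basis of $H_1(E_t,\mathbb Z)$ with $\langle\delta_1,\delta_2\rangle=1$). Then the period matrix $$\mathrm{pm}(t)=\frac1{\sqrt{2\pi i}}\begin{pmatrix}\int_{\delta_1}\omega_1&\int_{\delta_1}\omega_2\\ \int_{\delta_2}\omega_1&\int_{\delta_2}\omega_2\end{pmatrix}$$ is holomorphic on $U$ and satisfies $$d\,\mathrm{pm}(t)=\mathrm{pm}(t)\cdot A^{\mathrm{tr}},\qquad A=\frac1\Delta\sum_{i=0}^3A_i\,dt_i,$$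 where $$A_0=\begin{pmatrix}\frac32t_0t_1t_2t_3-9t_0t_3^2+\frac14t_2^3&-\frac32t_0t_2t_3\\ \frac32t_0t_1^2t_2t_3+9t_0t_1t_3^2-\frac12t_1t_2^3+\frac18t_2^2t_3&-\frac32t_0t_1t_2t_3-18t_0t_3^2+\frac34t_2^3\end{pmatrix},$$ $$A_1=\begin{pmatrix}0&0\\27t_0^2t_3^2-t_0t_2^3&0\end{pmatrix},$$ $$A_2=\begin{pmatrix}-\frac92t_0^2t_1t_3+\frac14t_0t_2^2&\frac92t_0^2t_3\\-\frac92t_0^2t_1^2t_3+\frac12t_0t_1t_2^2-\frac38t_0t_2t_3&\frac92t_0^2t_1t_3-\frac14t_0t_2^2\end{pmatrix},$$ $$A_3=\begin{pmatrix}3t_0^2t_1t_2-\frac92t_0^2t_3&-3t_0^2t_2\\3t_0^2t_1^2t_2-9t_0^2t_1t_3+\frac14t_0t_2^2&-3t_0^2t_1t_2+\frac92t_0^2t_3\end{pmatrix}.$$ Moreover, $A$ is the matrix of the algebraic Gauss–Manin connection $\nabla$ of the generic curve $E$ over $\mathbb Q(t)=\mathbb Q(t_0,t_1,t_2,t_3)$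 in the basis $(\omega_1,\omega_2)$ of $H^1_{\mathrm{dR}}(E)$: $\nabla\omega_j=\sum_kA_{jk}\otimes\omega_k$. That is, if $L=\mathbb Q(t)(x,y)$ is the function field of $E$ and $D$ is any derivation of $L$ extending $\frac{\partial}{\partial t_i}$ on $\mathbb Q(t)$, then for $i=0,\dots,3$ and $j=1,2$ the Lie derivative of $\omega_j$ along $D$, where $D$ acts on relative differentials by $f\,dg\mapsto D(f)\,dg+f\,d(D(g))$, equals $\frac1\Delta\sum_{k=1}^2(A_i)_{jk}\,\omega_k$ in $\Omega^1_{L/\mathbb Q(t)}$ modulo the exact forms $dh$, $h\in L$. -/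

import Mathlib

open Polynomial MeasureTheory
open scoped Topology

noncomputable section

namespace EllipticFamily

/-! ### The family and the explicit matrices, over an arbitrary field of parameters -/

/-- The cubic polynomial `4 t₀ (x - t₁)³ - t₂ (x - t₁) - t₃`. -/
def cubic {R : Type*} [Field R] (t : Fin 4 → R) : R[X] :=
  C (4 * t 0) * (X - C (t 1)) ^ 3 - C (t 2) * (X - C (t 1)) - C (t 3)

/-- The discriminant `Δ = t₀ (27 t₀ t₃² - t₂³)`. -/
def disc {R : Type*} [Field R] (t : Fin 4 → R) : R :=
  t 0 * (27 * t 0 * t 3 ^ 2 - t 2 ^ 3)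

/-- The polynomial matrices `A₀, A₁, A₂, A₃`. -/
def matA {R : Type*} [Field R] (t : Fin 4 → R) : Fin 4 → Matrix (Fin 2) (Fin 2) R :=
  ![!![3 / 2 * t 0 * t 1 * t 2 * t 3 - 9 * t 0 * t 3 ^ 2 + 1 / 4 * t 2 ^ 3,
        -(3 / 2) * t 0 * t 2 * t 3;
       3 / 2 * t 0 * t 1 ^ 2 * t 2 * t 3 + 9 * t 0 * t 1 * t 3 ^ 2
          - 1 / 2 * t 1 * t 2 ^ 3 + 1 / 8 * t 2 ^ 2 * t 3,
        -(3 / 2) * t 0 * t 1 * t 2 * t 3 - 18 * t 0 * t 3 ^ 2 + 3 / 4 * t 2 ^ 3],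
    !![0, 0;
       27 * t 0 ^ 2 * t 3 ^ 2 - t 0 * t 2 ^ 3, 0],
    !![-(9 / 2) * t 0 ^ 2 * t 1 * t 3 + 1 / 4 * t 0 * t 2 ^ 2,
        9 / 2 * t 0 ^ 2 * t 3;
       -(9 / 2) * t 0 ^ 2 * t 1 ^ 2 * t 3 + 1 / 2 * t 0 * t 1 * t 2 ^ 2
          - 3 / 8 * t 0 * t 2 * t 3,
        9 / 2 * t 0 ^ 2 * t 1 * t 3 - 1 / 4 * t 0 * t 2 ^ 2],
    !![3 * t 0 ^ 2 * t 1 * t 2 - 9 / 2 * t 0 ^ 2 * t 3,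
        -3 * t 0 ^ 2 * t 2;
       3 * t 0 ^ 2 * t 1 ^ 2 * t 2 - 9 * t 0 ^ 2 * t 1 * t 3 + 1 / 4 * t 0 * t 2 ^ 2,
        -3 * t 0 ^ 2 * t 1 * t 2 + 9 / 2 * t 0 ^ 2 * t 3]]

/-! ### Periods -/

/-- The parameter space `T = ℂ⁴ ∖ {Δ = 0}`. -/
def T : Set (Fin 4 → ℂ) := {t | disc t ≠ 0}

/-- The (affine) curve `E_t = {y² = 4 t₀ (x - t₁)³ - t₂ (x - t₁) - t₃}` in `ℂ²`. -/
def E (t : Fin 4 → ℂ) : Set (ℂ × ℂ) := {q | q.2 ^ 2 = (cubic t).eval q.1}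

/-- The regular 1-form `dx / y` on `E_t`. On `E_t` one has `2 y dy = p'(x) dx`, with `p` the cubic,
so at the points with `y = 0` the form `dx / y` is `2 dy / p'(x)`. -/
def dxOverY (t : Fin 4 → ℂ) (q : ℂ × ℂ) : ℂ × ℂ →L[ℂ] ℂ :=
  open Classical in
  if q.2 ≠ 0 then q.2⁻¹ • ContinuousLinearMap.fst ℂ ℂ ℂ
  else (2 / (cubic t).derivative.eval q.1) • ContinuousLinearMap.snd ℂ ℂ ℂ

/-- The 1-forms `ω₁ = dx / y` and `ω₂ = x dx / y` on `E_t` (indexed by `0` and `1`). -/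
def ω (t : Fin 4 → ℂ) (j : Fin 2) (q : ℂ × ℂ) : ℂ × ℂ →L[ℂ] ℂ :=
  q.1 ^ (j : ℕ) • dxOverY t q

/-- A continuous family of cycles `δ_t ⊂ E_t`, `t ∈ U`: closed `C¹` paths in `E_t` that depend
continuously on `t`. (As `E_t` is connected, every class in `H₁(E_t, ℤ)` is the class of such a
closed path.) The values for `t ∉ U` are irrelevant. -/
structure CycleFamily (U : Set (Fin 4 → ℂ)) where
  /-- the base point of the cycle in `E_t` -/
  base : (Fin 4 → ℂ) → ℂ × ℂ
  /-- the closed path `δ_t` -/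
  loop : ∀ t, Path (base t) (base t)
  mem_E : ∀ t ∈ U, ∀ s, loop t s ∈ E t
  contDiffOn : ∀ t ∈ U, ContDiffOn ℝ 1 (loop t).extend (Set.Icc 0 1)
  continuousOn : ContinuousOn (fun q : (Fin 4 → ℂ) × unitInterval => loop q.1 q.2)
    (U ×ˢ Set.univ)

/-- The period `∫_{δ_t} ω_j`. -/
def CycleFamily.period {U : Set (Fin 4 → ℂ)} (δ : CycleFamily U) (j : Fin 2)
    (t : Fin 4 → ℂ) : ℂ :=
  curveIntegral (ω t j) (δ.loop t)

/-- The period matrix `(2πi)^(-1/2) (∫_{δ_a} ω_b)_{a, b}`. -/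
def pm {U : Set (Fin 4 → ℂ)} (δ : Fin 2 → CycleFamily U) (t : Fin 4 → ℂ) :
    Matrix (Fin 2) (Fin 2) ℂ :=
  Matrix.of fun a b => 1 / (2 * (Real.pi : ℂ) * Complex.I) ^ (1 / 2 : ℂ) * (δ a).period b t

/-- The matrix of 1-forms `A = (1/Δ) ∑ A_i dt_i` on `T`. -/
def connA (t : Fin 4 → ℂ) : Matrix (Fin 2) (Fin 2) ((Fin 4 → ℂ) →L[ℂ] ℂ) :=
  Matrix.of fun j k =>
    (1 / disc t) • ∑ i : Fin 4, matA t i j k • ContinuousLinearMap.proj (R := ℂ) i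

/-! ### The algebraic Gauss-Manin connection -/

/-- The field `ℚ(t₀, t₁, t₂, t₃)`. -/
abbrev K : Type := FractionRing (MvPolynomial (Fin 4) ℚ)

/-- The generic parameter `(t₀, t₁, t₂, t₃)`, with coordinates in `ℚ(t)`. -/
def tK : Fin 4 → K := fun i => algebraMap (MvPolynomial (Fin 4) ℚ) K (MvPolynomial.X i)

/-- `L = ℚ(t)(x, y)` is the function field of the generic curve of the family. -/
structure IsFunctionField {L : Type*} [Field L] [Algebra K L] (x y : L) : Prop where
  transcendental : Transcendental K x
  equation : y ^ 2 = aeval x (cubic tK)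
  generates : IntermediateField.adjoin K {x, y} = ⊤

/-- `D` extends the derivation `∂/∂t_i` of `ℚ(t)` to `L`. (Derivations over `ℤ` of a field of
characteristic zero are the same as derivations over `ℚ`.) -/
def ExtendsPartial {L : Type*} [Field L] [Algebra K L] (i : Fin 4) (D : Derivation ℤ L L) : Prop :=
  ∀ q : MvPolynomial (Fin 4) ℚ,
    D (algebraMap K L (algebraMap _ K q)) = algebraMap K L (algebraMap _ K (MvPolynomial.pderiv i q))

/-- The relative 1-form `x ^ j dx / y` of `L` over `ℚ(t)`. -/
def ωK {L : Type*} [Field L] [Algebra K L] (x y : L) (j : Fin 2) : Ω[L⁄K] :=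
  (x ^ (j : ℕ) / y) • KaehlerDifferential.D K L x

/-- The Lie derivative `D(f) dg + f d(D g)` of the relative 1-form `f dg` along `D`. Modulo exact
forms, the Lie derivative along any extension of `∂/∂t_i` is the Gauss-Manin connection
`∇_{∂/∂t_i}`. -/
def lieDerivative {L : Type*} [Field L] [Algebra K L] (D : Derivation ℤ L L) (f g : L) : Ω[L⁄K] :=
  D f • KaehlerDifferential.D K L g + f • KaehlerDifferential.D K L (D g)

/-- The exact relative 1-forms `dh`, `h ∈ L`. -/
def exactForms (L : Type*) [Field L] [Algebra K L] : Submodule K Ω[L⁄K] :=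
  LinearMap.range (KaehlerDifferential.D K L).toLinearMap

end EllipticFamily

end

/-! Both halves rest on one polynomial identity. Write p for the cubic and p_i for its derivative in
t_i. On y² = p, with x held constant, ∂_i(x^j dx/y) = -x^j p_i dx/(2y³), while d(r/y) = (2r'p - rp')
dx/(2y³). So -Δ x^j p_i = 2(∑_k (A_i)_{jk} x^k + r')p - rp' (`cubicPartial_reduction`) says exactly
that Δ ∂_i ω_j = ∑_k (A_i)_{jk} ω_k + d(r/y).

Over the function field, a derivation D need not kill x; this changes the Lie derivative only by the
exact form d(x^j Dx/y), the contraction of ω_j with D (`lieDerivative_sub_eq_exact`).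

For periods, the cycles are merely continuous in t, so the integral over δ_t cannot be
differentiated in t directly. Instead, ω_j gets local primitives F_j on the total space, holomorphic
in t and in a coordinate of the curve (`exists_localPeriod`). Normalized suitably, they satisfy dF_j
= ∑_k A_jk F_k + boundary term at t₀, where the boundary term depends on the point and the tangent
vector but not on the chart. Hence two such systems at one point differ by functions c_j of t with
dc_j = ∑_k c_k A_jk at t₀ (`LocalPeriod.exists_sub_eq`). Primitives are continued along the cycle by
connectedness of [0,1]. Since the cycle closes up, its period is the difference of the final and
initial primitives at the same point, and so satisfies the equation
(`CycleFamily.hasFDerivAt_period`). -/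

namespace EllipticFamily

/-! ### Reduction of the differentiated forms modulo exact forms -/

/-- The partial derivatives of the cubic polynomial with respect to the parameters. -/
noncomputable def cubicPartial {R : Type*} [Field R] (t : Fin 4 → R) : Fin 4 → R[X] :=
  ![C 4 * (X - C (t 1)) ^ 3, C (t 2) - C (12 * t 0) * (X - C (t 1)) ^ 2, -(X - C (t 1)), -1]

/-- The quadratic polynomials `r` for which `d (r / (Δ y))` is the exact part of the derivative of
`x ^ j dx / y` with respect to `t_i` at constant `x`. -/
noncomputable def exactPart {R : Type*} [Field R] (t : Fin 4 → R) : Fin 4 → Fin 2 → R[X] :=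
  let Y : R[X] := X - C (t 1)
  let r₀ : R[X] := C (6 * t 0 ^ 2 * t 2) * Y ^ 2 - C (9 * t 0 ^ 2 * t 3) * Y - C (t 0 * t 2 ^ 2)
  let r₁ : R[X] := C (-9 * t 0 ^ 2 * t 3) * Y ^ 2 + C (1 / 2 * t 0 * t 2 ^ 2) * Y
    + C (3 / 2 * t 0 * t 2 * t 3)
  let r₂ : R[X] := C (1 / 2 * t 0 * t 2 ^ 2) * Y ^ 2 - C (3 / 4 * t 0 * t 2 * t 3) * Y
    - C (9 / 4 * t 0 * t 3 ^ 2)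
  let s₀ : R[X] := C (3 * t 0 * t 2 * t 3) * Y ^ 2
    + C (9 * t 0 * t 3 ^ 2 - 1 / 2 * t 2 ^ 3) * Y - C (1 / 2 * t 2 ^ 2 * t 3)
  let s₁ : R[X] := C (9 * t 0 * t 3 ^ 2 - 1 / 2 * t 2 ^ 3) * Y ^ 2
    + C (1 / 4 * t 2 ^ 2 * t 3) * Y + C (3 / 4 * t 2 * t 3 ^ 2)
  ![![s₀, s₁ + C (t 1) * s₀], ![-C (disc t), -C (disc t) * X],
    ![r₁, r₂ + C (t 1) * r₁], ![r₀, r₁ + C (t 1) * r₀]]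

theorem derivative_cubic {R : Type*} [Field R] (t : Fin 4 → R) :
    derivative (cubic t) = C (12 * t 0) * (X - C (t 1)) ^ 2 - C (t 2) := by
  simp only [cubic, derivative_sub, derivative_mul, derivative_C, derivative_pow, derivative_X,
    map_mul, map_ofNat, Nat.cast_ofNat, derivative_ofNat]
  ring

/-- The choices of r come from powers of Y = x - t₁: r_m reduces Y^m dx/y³ and s_m reduces Y^(m+3)
dx/y³, up to constant factors. Since x = Y + t₁, the case j = 1 adds t₁ times the case j = 0. For i
= 1 the parameter only translates x, so p₁ = -p' and r = -Δ x^j. -/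
theorem cubicPartial_reduction {R : Type*} [Field R] [CharZero R] (t : Fin 4 → R) (i : Fin 4)
    (j : Fin 2) :
    -(C (disc t) * X ^ (j : ℕ) * cubicPartial t i) =
      2 * (∑ k : Fin 2, C (matA t i j k) * X ^ (k : ℕ) + derivative (exactPart t i j)) * cubic t
        - exactPart t i j * derivative (cubic t) := by
  -- A field of characteristic zero is infinite, so the identity may be checked on values.
  refine Polynomial.funext fun x => ?_
  fin_cases i <;> fin_cases j <;>
    simp [cubicPartial, exactPart, matA, cubic, disc, derivative_pow] <;> ring

/-! ### The Gauss–Manin connection on the function field -/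

section AlgebraicConnection

variable {L : Type*} [Field L] [Algebra K L]

instance : CharZero K := algebraRat.charZero K

theorem disc_tK_ne_zero : disc tK ≠ 0 := by
  have h : disc tK = algebraMap (MvPolynomial (Fin 4) ℚ) K
      (MvPolynomial.X 0 * (27 * MvPolynomial.X 0 * MvPolynomial.X 3 ^ 2 - MvPolynomial.X 2 ^ 3)) := by
    simp only [disc, tK, map_sub, map_mul, map_pow, map_ofNat]
  rw [h, Ne, FaithfulSMul.algebraMap_eq_zero_iff]
  intro h0
  -- At (1, 0, 0, 1) the discriminant is 27.
  simpa using congrArg (MvPolynomial.eval ![1, 0, 0, 1]) h0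

theorem ExtendsPartial.map_tK {i : Fin 4} {D : Derivation ℤ L L} (hD : ExtendsPartial i D)
    (m : Fin 4) : D (algebraMap K L (tK m)) = if m = i then 1 else 0 := by
  rw [tK, hD, MvPolynomial.pderiv_X, Pi.single_apply]
  split_ifs <;> simp_all

/-- If y vanished, the transcendental x would be a root of the cubic, forcing the cubic to be zero.
Its second difference at t₁, t₁ + 1, t₁ + 2 is 24 t₀, so t₀ and hence Δ would vanish. -/
theorem IsFunctionField.y_ne_zero {x y : L} (h : IsFunctionField x y) : y ≠ 0 := by
  rintro rfl
  have h0 : aeval x (cubic tK) = 0 := by rw [← h.equation]; simp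
  have hc := (transcendental_iff.1 h.transcendental) _ h0
  have h2 : (cubic tK).eval (tK 1 + 1) = 0 := by rw [hc]; simp
  have h3 : (cubic tK).eval (tK 1) = 0 := by rw [hc]; simp
  have h5 : (cubic tK).eval (tK 1 + 2) = 0 := by rw [hc]; simp
  simp [cubic] at h2 h3 h5
  have h6 : tK 0 = 0 := by linear_combination (1 / 24) * h5 - (1 / 12) * h2 - (1 / 24) * h3
  exact disc_tK_ne_zero (by simp [disc, h6])

theorem ExtendsPartial.map_aeval_cubic {i : Fin 4} {D : Derivation ℤ L L}
    (hD : ExtendsPartial i D) (x : L) :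
    D (aeval x (cubic tK)) =
      aeval x (cubicPartial tK i) + aeval x (derivative (cubic tK)) * D x := by
  have h := hD.map_tK
  have h4 : D (4 : L) = 0 := by simpa using D.map_natCast 4
  rw [derivative_cubic]
  simp only [cubic, map_sub, map_mul, map_pow, aeval_C, aeval_X,
    Derivation.leibniz, Derivation.leibniz_pow, smul_eq_mul, h, map_ofNat, h4]
  fin_cases i <;>
    simp only [cubicPartial, Fin.isValue, Matrix.cons_val, map_sub, map_mul, map_pow, map_neg,
      map_one, aeval_C, aeval_X, map_ofNat, Fin.reduceFinMk, Fin.reduceEq, if_true, if_false,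
      Fin.zero_eta, Fin.mk_one] <;> simp <;> ring

/-- The primitive has two sources: x^j Dx/y accounts for D moving x, as in Cartan's formula, and
r/(Δy) is the exact part of the derivative at constant x. -/
theorem lieDerivative_sub_eq_exact {x y : L} (h : IsFunctionField x y) {i : Fin 4}
    {D : Derivation ℤ L L} (hD : ExtendsPartial i D) (j : Fin 2) :
    lieDerivative D (x ^ (j : ℕ) / y) x -
        ∑ k : Fin 2, (1 / disc tK * matA tK i j k) • ωK x y k =
      KaehlerDifferential.D K L (x ^ (j : ℕ) / y * D x +
        algebraMap K L (1 / disc tK) * (aeval x (exactPart tK i j) / y)) := by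
  have hy := h.y_ne_zero
  have : CharZero L := charZero_of_injective_algebraMap (algebraMap K L).injective
  have hδ : algebraMap K L (disc tK) ≠ 0 := by simpa using disc_tK_ne_zero
  set d := KaehlerDifferential.D K L with hd
  set p' := aeval x (derivative (cubic tK)) with hp'
  set q := aeval x (cubicPartial tK i) with hq
  set r := aeval x (exactPart tK i j) with hr
  set r' := aeval x (derivative (exactPart tK i j)) with hr'
  -- The value m' = j x^(j-1) can be forgotten: its contributions to both sides cancel.
  obtain ⟨m', hm, hDm⟩ : ∃ m' : L, d (x ^ (j : ℕ)) = m' • d x ∧ D (x ^ (j : ℕ)) = m' * D x :=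
    ⟨(j : ℕ) * x ^ ((j : ℕ) - 1), by simp [mul_smul, Nat.cast_smul_eq_nsmul], by simp [mul_assoc]⟩
  have hdr : d r = r' • d x := Derivation.map_aeval _ _ _
  have hdy : d y = (p' / (2 * y)) • d x := by
    have h1 : d (y ^ 2) = p' • d x := by rw [h.equation]; exact Derivation.map_aeval _ _ _
    rw [Derivation.leibniz_pow] at h1
    rw [div_eq_inv_mul, mul_smul, ← h1, pow_one, ← Nat.cast_smul_eq_nsmul L, smul_smul, smul_smul]
    rw [show (2 * y)⁻¹ * ((2 : ℕ) : L) * y = 1 by push_cast; field_simp, one_smul]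
  have hDy : D y = (q + p' * D x) / (2 * y) := by
    have h1 : D (y ^ 2) = q + p' * D x := by rw [h.equation]; exact hD.map_aeval_cubic x
    rw [Derivation.leibniz_pow] at h1
    rw [← h1]
    simp
    field_simp
  have hred : -(algebraMap K L (disc tK) * x ^ (j : ℕ) * q) =
      2 * (∑ k : Fin 2, algebraMap K L (matA tK i j k) * x ^ (k : ℕ) + r') * y ^ 2 - r * p' := by
    have h1 := congrArg (aeval x) (cubicPartial_reduction tK i j)
    rw [h.equation]
    simpa [hq, hr, hr', hp', map_ofNat] using h1
  rw [lieDerivative, ← hd]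
  have hexact : d (x ^ (j : ℕ) / y * D x + algebraMap K L (1 / disc tK) * (r / y)) =
      (x ^ (j : ℕ) / y) • d (D x) + (D x * (m' / y - x ^ (j : ℕ) * p' / (2 * y ^ 3)) +
        (r' / y - r * p' / (2 * y ^ 3)) / algebraMap K L (disc tK)) • d x := by
    rw [map_add, Derivation.leibniz, Derivation.leibniz, Derivation.leibniz_div,
      Derivation.leibniz_div, Derivation.map_algebraMap, hm, hdr, hdy, map_div₀, map_one]
    match_scalars <;> field_simp
  have hform : ∑ k : Fin 2, (1 / disc tK * matA tK i j k) • ωK x y k =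
      ((∑ k : Fin 2, algebraMap K L (matA tK i j k) * x ^ (k : ℕ)) /
        (algebraMap K L (disc tK) * y)) • d x := by
    simp only [ωK, ← hd, algebra_compatible_smul L (_ : K), Fin.sum_univ_two, map_mul, map_div₀,
      map_one]
    match_scalars
    field_simp
  rw [hexact, hform, Derivation.leibniz_div, hDm, hDy]
  generalize (∑ k : Fin 2, algebraMap K L (matA tK i j k) * x ^ (k : ℕ)) = S at hred ⊢
  simp only [smul_eq_mul]
  match_scalars
  · field_simp
    linear_combination hred
  · ring

theorem mkQ_lieDerivative {x y : L} (h : IsFunctionField x y) {i : Fin 4}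
    {D : Derivation ℤ L L} (hD : ExtendsPartial i D) (j : Fin 2) :
    (exactForms L).mkQ (lieDerivative D (x ^ (j : ℕ) / y) x) =
      ∑ k : Fin 2, (1 / disc tK * matA tK i j k) • (exactForms L).mkQ (ωK x y k) := by
  rw [← sub_eq_zero]
  simp_rw [← map_smul]
  rw [← map_sum, ← map_sub, lieDerivative_sub_eq_exact h hD]
  simp only [Submodule.mkQ_apply, Submodule.Quotient.mk_eq_zero]
  exact ⟨_, rfl⟩

end AlgebraicConnection

/-! ### Holomorphic primitives depending on parameters -/

section ParametricPrimitive

open Metric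

/-- The primitive in the last variable, given by integration along segments from `u₀`. -/
noncomputable def radialPrimitive {H : Type*} (u₀ : ℂ) (g : H × ℂ → ℂ) (z : H × ℂ) : ℂ :=
  ∫ v in (0 : ℝ)..1, (z.2 - u₀) * g (z.1, u₀ + v * (z.2 - u₀))

theorem radialPrimitive_self {H : Type*} (u₀ : ℂ) (g : H × ℂ → ℂ) (t : H) :
    radialPrimitive u₀ g (t, u₀) = 0 := by
  simp [radialPrimitive]

theorem radial_mem_closedBall {H : Type*} [NormedAddCommGroup H] {t₀ : H} {u₀ : ℂ} {r : ℝ} {z : H × ℂ}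
    (hz : z ∈ closedBall (t₀, u₀) r) {v : ℝ} (hv : v ∈ Set.Icc (0 : ℝ) 1) :
    (z.1, u₀ + v * (z.2 - u₀)) ∈ closedBall (t₀, u₀) r := by
  rw [mem_closedBall, Prod.dist_eq, max_le_iff] at hz ⊢
  refine ⟨hz.1, le_trans ?_ hz.2⟩
  rw [dist_eq_norm, dist_eq_norm, add_sub_cancel_left, norm_mul]
  refine mul_le_of_le_one_left (norm_nonneg _) ?_
  rw [Complex.norm_real, Real.norm_of_nonneg hv.1]
  exact hv.2

/-- Differentiation under the integral sign. The derivative in t stays an integral; the derivative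
in u has integrand d/dv (v g(t, u₀ + v(u - u₀))), which integrates to g. -/
theorem hasFDerivAt_radialPrimitive {H : Type*} [NormedAddCommGroup H]
    [NormedSpace ℂ H] [ProperSpace H] {t₀ : H} {u₀ : ℂ} {ρ : ℝ} {g : H × ℂ → ℂ}
    (hg : ContDiffOn ℂ 1 g (ball (t₀, u₀) ρ)) {z : H × ℂ} (hz : z ∈ ball (t₀, u₀) ρ) :
    ∃ L : H × ℂ →L[ℂ] ℂ, HasFDerivAt (radialPrimitive u₀ g) L z ∧
      ∀ τ ν, L (τ, ν) = radialPrimitive u₀ (fun w => fderiv ℂ g w (τ, 0)) z + g z * ν := by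
  -- A smaller closed ball is compact, which supplies the constant bound for dominated convergence.
  obtain ⟨r, hzr, hrρ⟩ := exists_between (mem_ball.1 hz)
  have hsub : closedBall (t₀, u₀) r ⊆ ball (t₀, u₀) ρ := closedBall_subset_ball hrρ
  have hgc : ContinuousOn g (closedBall (t₀, u₀) r) := hg.continuousOn.mono hsub
  have hg'c : ContinuousOn (fderiv ℂ g) (closedBall (t₀, u₀) r) :=
    (hg.continuousOn_fderiv_of_isOpen isOpen_ball le_rfl).mono hsub
  have hK : IsCompact (closedBall (t₀, u₀) r) := isCompact_closedBall _ _
  set pt : H × ℂ → ℝ → H × ℂ := fun w v => (w.1, u₀ + v * (w.2 - u₀)) with hpt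
  set F' : H × ℂ → ℝ → H × ℂ →L[ℂ] ℂ := fun w v =>
    (w.2 - u₀) • (fderiv ℂ g (pt w v)).comp
      ((ContinuousLinearMap.fst ℂ H ℂ).prod ((v : ℂ) • ContinuousLinearMap.snd ℂ H ℂ)) +
    g (pt w v) • ContinuousLinearMap.snd ℂ H ℂ with hF'
  have hptc : ∀ w, Continuous (pt w) := fun w => by fun_prop
  have hmaps : ∀ w ∈ closedBall (t₀, u₀) r, Set.MapsTo (pt w) (Set.Icc 0 1)
      (closedBall (t₀, u₀) r) := fun w hw v hv => radial_mem_closedBall hw hv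
  have hFc : ∀ w ∈ closedBall (t₀, u₀) r,
      ContinuousOn (fun v => (w.2 - u₀) * g (pt w v)) (Set.Icc 0 1) := fun w hw =>
    continuousOn_const.mul (hgc.comp (hptc w).continuousOn (hmaps w hw))
  have hF'j : ContinuousOn (fun q : (H × ℂ) × ℝ => F' q.1 q.2)
      (closedBall (t₀, u₀) r ×ˢ Set.Icc 0 1) := by
    have hpc : ContinuousOn (fun q : (H × ℂ) × ℝ => pt q.1 q.2)
      (closedBall (t₀, u₀) r ×ˢ Set.Icc 0 1) := Continuous.continuousOn (by fun_prop)
    have hm : Set.MapsTo (fun q : (H × ℂ) × ℝ => pt q.1 q.2)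
      (closedBall (t₀, u₀) r ×ˢ Set.Icc 0 1) (closedBall (t₀, u₀) r) :=
      fun q hq => hmaps q.1 hq.1 hq.2
    have h1 : ContinuousOn (fun q : (H × ℂ) × ℝ => fderiv ℂ g (pt q.1 q.2))
      (closedBall (t₀, u₀) r ×ˢ Set.Icc 0 1) := hg'c.comp hpc hm
    have h2 : ContinuousOn (fun q : (H × ℂ) × ℝ => g (pt q.1 q.2))
      (closedBall (t₀, u₀) r ×ˢ Set.Icc 0 1) := hgc.comp hpc hm
    have h3 : ContinuousOn (fun q : (H × ℂ) × ℝ => (ContinuousLinearMap.fst ℂ H ℂ).prod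
      ((q.2 : ℂ) • ContinuousLinearMap.snd ℂ H ℂ)) (closedBall (t₀, u₀) r ×ˢ Set.Icc 0 1) := by
      have h4 : (fun q : (H × ℂ) × ℝ => (ContinuousLinearMap.fst ℂ H ℂ).prod
          ((q.2 : ℂ) • ContinuousLinearMap.snd ℂ H ℂ)) = fun q : (H × ℂ) × ℝ =>
          (ContinuousLinearMap.inl ℂ H ℂ).comp (ContinuousLinearMap.fst ℂ H ℂ) +
          (q.2 : ℂ) • (ContinuousLinearMap.inr ℂ H ℂ).comp (ContinuousLinearMap.snd ℂ H ℂ) := by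
        ext q : 1
        ext <;> simp
      rw [h4]
      fun_prop
    have h5 := h1.clm_comp h3
    exact ((by fun_prop : ContinuousOn (fun q : (H × ℂ) × ℝ => q.1.2 - u₀) _).smul h5).add
      (h2.smul continuousOn_const)
  have hF'c : ∀ w ∈ closedBall (t₀, u₀) r, ContinuousOn (F' w) (Set.Icc 0 1) := fun w hw =>
    hF'j.comp (f := fun v => (w, v)) (Continuous.continuousOn (by fun_prop)) fun v hv => ⟨hw, hv⟩
  obtain ⟨C, hC⟩ :=
    (hK.prod (isCompact_Icc (a := (0 : ℝ)) (b := 1))).exists_bound_of_continuousOn hF'j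
  have hIoc : Set.uIoc (0 : ℝ) 1 ⊆ Set.Icc 0 1 := by
    rw [Set.uIoc_of_le zero_le_one]; exact Set.Ioc_subset_Icc_self
  have hzc : z ∈ closedBall (t₀, u₀) r := mem_closedBall.2 hzr.le
  have hnhds : closedBall (t₀, u₀) r ∈ 𝓝 z :=
    Filter.mem_of_superset (isOpen_ball.mem_nhds (mem_ball.2 hzr)) ball_subset_closedBall
  have hderiv := intervalIntegral.hasFDerivAt_integral_of_dominated_of_fderiv_le
    (F := fun w v => (w.2 - u₀) * g (pt w v)) (F' := F') (x₀ := z) (μ := volume) (a := 0) (b := 1)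
    (bound := fun _ => C) hnhds
    (Filter.eventually_of_mem hnhds fun w hw =>
      ((hFc w hw).mono hIoc).aestronglyMeasurable measurableSet_uIoc)
    (ContinuousOn.intervalIntegrable (by rw [Set.uIcc_of_le zero_le_one]; exact hFc z hzc))
    (((hF'c z hzc).mono hIoc).aestronglyMeasurable measurableSet_uIoc)
    (.of_forall fun v hv w hw => hC (w, v) ⟨hw, hIoc hv⟩)
    intervalIntegrable_const
    (.of_forall fun v hv w hw => by
      have hd : HasFDerivAt g (fderiv ℂ g (pt w v)) (pt w v) :=
        ((hg.differentiableOn one_ne_zero).differentiableAt (isOpen_ball.mem_nhds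
          (hsub (hmaps w hw (hIoc hv))))).hasFDerivAt
      have hp : HasFDerivAt (fun w : H × ℂ => pt w v)
          ((ContinuousLinearMap.fst ℂ H ℂ).prod ((v : ℂ) • ContinuousLinearMap.snd ℂ H ℂ)) w :=
        hasFDerivAt_fst.prodMk (((hasFDerivAt_snd.sub_const u₀).const_mul (v : ℂ)).const_add u₀)
      have h3 := (hasFDerivAt_snd.sub_const u₀).mul (hd.comp w hp)
      exact h3)
  refine ⟨_, hderiv, fun τ ν => ?_⟩
  have hint : IntervalIntegrable (F' z) volume 0 1 :=
    ContinuousOn.intervalIntegrable (by rw [Set.uIcc_of_le zero_le_one]; exact hF'c z hzc)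
  rw [ContinuousLinearMap.intervalIntegral_apply hint]
  have hdv : ∀ v ∈ Set.uIcc (0 : ℝ) 1,
      HasDerivAt (fun v : ℝ => (v : ℂ) * g (pt z v))
        (g (pt z v) + v * (z.2 - u₀) * fderiv ℂ g (pt z v) (0, 1)) v := fun v hv => by
    rw [Set.uIcc_of_le zero_le_one] at hv
    have hd : HasFDerivAt g (fderiv ℂ g (pt z v)) (pt z v) :=
      ((hg.differentiableOn one_ne_zero).differentiableAt (isOpen_ball.mem_nhds
        (hsub (hmaps z hzc hv)))).hasFDerivAt
    have hp : HasDerivAt (pt z) (0, (z.2 - u₀)) v := by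
      have := ((Complex.ofRealCLM.hasDerivAt (x := v)).mul_const (z.2 - u₀)).const_add u₀
      simpa using (hasDerivAt_const v z.1).prodMk this
    have h3 := (Complex.ofRealCLM.hasDerivAt (x := v)).mul
      ((hd.restrictScalars ℝ).comp_hasDerivAt v hp)
    have h4 : fderiv ℂ g (pt z v) (0, z.2 - u₀) = (z.2 - u₀) * fderiv ℂ g (pt z v) (0, 1) := by
      rw [← smul_eq_mul, ← map_smul]; simp
    convert! h3 using 1
    simp [h4]
    ring
  have hc1 : ContinuousOn (fun v : ℝ => fderiv ℂ g (pt z v)) (Set.Icc 0 1) :=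
    hg'c.comp (hptc z).continuousOn (hmaps z hzc)
  have hc2 : ContinuousOn (fun v : ℝ => g (pt z v)) (Set.Icc 0 1) :=
    hgc.comp (hptc z).continuousOn (hmaps z hzc)
  have hi2 : IntervalIntegrable
      (fun v : ℝ => g (pt z v) + v * (z.2 - u₀) * fderiv ℂ g (pt z v) (0, 1)) volume 0 1 := by
    refine ContinuousOn.intervalIntegrable ?_
    rw [Set.uIcc_of_le zero_le_one]
    refine hc2.add (ContinuousOn.mul (Continuous.continuousOn (by fun_prop)) ?_)
    exact hc1.clm_apply continuousOn_const
  have hi1 : IntervalIntegrable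
      (fun v : ℝ => (z.2 - u₀) * fderiv ℂ g (pt z v) (τ, 0)) volume 0 1 := by
    refine ContinuousOn.intervalIntegrable ?_
    rw [Set.uIcc_of_le zero_le_one]
    exact continuousOn_const.mul (hc1.clm_apply continuousOn_const)
  have hftc := intervalIntegral.integral_eq_sub_of_hasDerivAt hdv hi2
  have hend : g z = ∫ v in (0 : ℝ)..1,
      (g (pt z v) + v * (z.2 - u₀) * fderiv ℂ g (pt z v) (0, 1)) := by
    rw [hftc]; simp [hpt]
  rw [radialPrimitive, hend, mul_comm _ ν, ← intervalIntegral.integral_const_mul,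
    ← intervalIntegral.integral_add hi1 (hi2.const_mul ν)]
  refine intervalIntegral.integral_congr fun v _ => ?_
  have hsplit : ((τ, (v : ℂ) * ν) : H × ℂ) = (τ, 0) + ((v : ℂ) * ν) • (0, 1) := by simp
  change (z.2 - u₀) * fderiv ℂ g (pt z v) (τ, (v : ℂ) * ν) + g (pt z v) * ν =
    (z.2 - u₀) * fderiv ℂ g (pt z v) (τ, 0) +
      ν * (g (pt z v) + v * (z.2 - u₀) * fderiv ℂ g (pt z v) (0, 1))
  rw [hsplit, map_add, map_smul, smul_eq_mul]
  ring

end ParametricPrimitive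

/-! ### The total space, its tangent vectors and its charts -/

/-- The derivative of the cubic polynomial in the parameter direction `τ`. -/
noncomputable def cubicVariation (t τ : Fin 4 → ℂ) : ℂ[X] := ∑ i, C (τ i) * cubicPartial t i

/-- `(τ, v)` is tangent at `(t, q)` to the total space of the family of curves. -/
def IsTangent (t : Fin 4 → ℂ) (q : ℂ × ℂ) (τ : Fin 4 → ℂ) (v : ℂ × ℂ) : Prop :=
  2 * q.2 * v.2 = (cubicVariation t τ).eval q.1 + (cubic t).derivative.eval q.1 * v.1

/-- The defining equation of the total space. -/
noncomputable def curveEq (z : (Fin 4 → ℂ) × ℂ × ℂ) : ℂ := z.2.2 ^ 2 - (cubic z.1).eval z.2.1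

theorem mem_E_iff {z : (Fin 4 → ℂ) × ℂ × ℂ} : z.2 ∈ E z.1 ↔ curveEq z = 0 := by
  rw [curveEq, sub_eq_zero]; rfl

theorem cubicVariation_zero (t : Fin 4 → ℂ) : cubicVariation t 0 = 0 := by
  simp [cubicVariation]

theorem eval_cubic (t : Fin 4 → ℂ) (x : ℂ) :
    (cubic t).eval x = 4 * t 0 * (x - t 1) ^ 3 - t 2 * (x - t 1) - t 3 := by
  simp [cubic]

theorem eval_derivative_cubic (t : Fin 4 → ℂ) (x : ℂ) :
    (cubic t).derivative.eval x = 12 * t 0 * (x - t 1) ^ 2 - t 2 := by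
  simp [derivative_cubic]

theorem eval_cubicVariation (t τ : Fin 4 → ℂ) (x : ℂ) :
    (cubicVariation t τ).eval x = 4 * τ 0 * (x - t 1) ^ 3
      + τ 1 * (t 2 - 12 * t 0 * (x - t 1) ^ 2) - τ 2 * (x - t 1) - τ 3 := by
  simp [cubicVariation, cubicPartial, Fin.sum_univ_four]
  ring

theorem eval_derivative_cubicVariation (t τ : Fin 4 → ℂ) (x : ℂ) :
    (cubicVariation t τ).derivative.eval x = 12 * τ 0 * (x - t 1) ^ 2
      - 24 * t 0 * τ 1 * (x - t 1) - τ 2 := by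
  simp [cubicVariation, cubicPartial, Fin.sum_univ_four, derivative_pow]
  ring

theorem contDiff_curveEq {n : WithTop ℕ∞} : ContDiff ℂ n curveEq := by
  unfold curveEq
  simp only [eval_cubic]
  fun_prop

theorem fderiv_curveEq (z : (Fin 4 → ℂ) × ℂ × ℂ) (τ : Fin 4 → ℂ) (v : ℂ × ℂ) :
    fderiv ℂ curveEq z (τ, v) = 2 * z.2.2 * v.2 - (cubicVariation z.1 τ).eval z.2.1
      - (cubic z.1).derivative.eval z.2.1 * v.1 := by
  have ht : ∀ i, HasFDerivAt (fun z : (Fin 4 → ℂ) × ℂ × ℂ => z.1 i)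
      ((ContinuousLinearMap.proj (R := ℂ) i).comp (ContinuousLinearMap.fst ℂ _ _)) z := fun i =>
    ((ContinuousLinearMap.proj (R := ℂ) i).comp
      (ContinuousLinearMap.fst ℂ (Fin 4 → ℂ) (ℂ × ℂ))).hasFDerivAt
  have hx : HasFDerivAt (fun z : (Fin 4 → ℂ) × ℂ × ℂ => z.2.1)
      ((ContinuousLinearMap.fst ℂ ℂ ℂ).comp (ContinuousLinearMap.snd ℂ _ _)) z :=
    ((ContinuousLinearMap.fst ℂ ℂ ℂ).comp
      (ContinuousLinearMap.snd ℂ (Fin 4 → ℂ) (ℂ × ℂ))).hasFDerivAt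
  have hy : HasFDerivAt (fun z : (Fin 4 → ℂ) × ℂ × ℂ => z.2.2)
      ((ContinuousLinearMap.snd ℂ ℂ ℂ).comp (ContinuousLinearMap.snd ℂ _ _)) z :=
    ((ContinuousLinearMap.snd ℂ ℂ ℂ).comp
      (ContinuousLinearMap.snd ℂ (Fin 4 → ℂ) (ℂ × ℂ))).hasFDerivAt
  have h := (hy.pow 2).sub (((((ht 0).const_mul 4).mul ((hx.sub (ht 1)).pow 3)).sub
    ((ht 2).mul (hx.sub (ht 1)))).sub (ht 3))
  have h' : HasFDerivAt curveEq _ z := h.congr_of_eventuallyEq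
    (.of_forall fun w => by simp [curveEq, eval_cubic])
  rw [h'.fderiv, eval_cubicVariation, eval_derivative_cubic]
  simp
  ring

theorem isTangent_iff {z : (Fin 4 → ℂ) × ℂ × ℂ} {τ : Fin 4 → ℂ} {v : ℂ × ℂ} :
    IsTangent z.1 z.2 τ v ↔ fderiv ℂ curveEq z (τ, v) = 0 := by
  rw [fderiv_curveEq, IsTangent, sub_sub, sub_eq_zero]

/-- Smoothness of the curve: a double root at Y = x - t₁ forces t₂ = 12 t₀ Y² and t₃ = -8 t₀ Y³,
whence 27 t₀ t₃² = t₂³. -/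
theorem derivative_cubic_ne_zero {t : Fin 4 → ℂ} (ht : t ∈ T) {q : ℂ × ℂ} (hq : q ∈ E t)
    (hy : q.2 = 0) : (cubic t).derivative.eval q.1 ≠ 0 := by
  intro h
  have h1 : (cubic t).eval q.1 = 0 := by rw [← show q.2 ^ 2 = _ from hq, hy]; simp
  rw [eval_cubic] at h1
  rw [eval_derivative_cubic] at h
  have h2 : t 2 = 12 * t 0 * (q.1 - t 1) ^ 2 := by linear_combination -h
  have h3 : t 3 = -8 * t 0 * (q.1 - t 1) ^ 3 := by linear_combination -h1 - (q.1 - t 1) * h2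
  refine ht ?_
  rw [disc, h2, h3]
  ring

theorem isInvertible_of_apply_one_ne_zero {A : ℂ →L[ℂ] ℂ} (h : A 1 ≠ 0) : A.IsInvertible := by
  refine ⟨ContinuousLinearEquiv.smulLeft (Units.mk0 _ h), ?_⟩
  ext
  simp [Units.smul_def]

/-- A holomorphic parametrization `Ψ` of the curves `E t` near `q₀`, for `t` near `t₀`, by the
coordinate `ℓ`. -/
structure Chart (t₀ : Fin 4 → ℂ) (q₀ : ℂ × ℂ) (ℓ : ℂ × ℂ →L[ℂ] ℂ)
    (Ψ : (Fin 4 → ℂ) × ℂ → ℂ × ℂ) : Prop where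
  contDiffAt : ContDiffAt ℂ 2 Ψ (t₀, ℓ q₀)
  base : Ψ (t₀, ℓ q₀) = q₀
  mem : ∀ᶠ z in 𝓝 (t₀, ℓ q₀), Ψ z ∈ E z.1 ∧ ℓ (Ψ z) = z.2
  inv : ∀ᶠ z in 𝓝 (t₀, q₀), z.2 ∈ E z.1 → Ψ (z.1, ℓ z.2) = z.2

/-- The implicit function theorem solves for y, as the y-derivative 2y of the equation is nonzero.
Class C² is kept so that the parameter derivative of a form in the chart is still C¹ and has a
radial primitive. -/
theorem exists_chart_fst {t₀ : Fin 4 → ℂ} {q₀ : ℂ × ℂ} (hq : q₀ ∈ E t₀) (hy : q₀.2 ≠ 0) :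
    ∃ Ψ, Chart t₀ q₀ (ContinuousLinearMap.fst ℂ ℂ ℂ) Ψ := by
  set f : ((Fin 4 → ℂ) × ℂ) × ℂ → ℂ := fun w => curveEq (w.1.1, w.1.2, w.2) with hf
  set u : ((Fin 4 → ℂ) × ℂ) × ℂ := ((t₀, q₀.1), q₀.2) with hu
  have hfu : f u = 0 := mem_E_iff.1 hq
  have hcd : ContDiffAt ℂ 2 f u := by
    have := (contDiff_curveEq (n := 2))
    fun_prop
  have hinv : (fderiv ℂ f u ∘L .inr ℂ _ _).IsInvertible := by
    refine isInvertible_of_apply_one_ne_zero ?_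
    have h1 : HasFDerivAt (fun w : ((Fin 4 → ℂ) × ℂ) × ℂ => (w.1.1, w.1.2, w.2))
        (ContinuousLinearEquiv.prodAssoc ℂ (Fin 4 → ℂ) ℂ ℂ :
          ((Fin 4 → ℂ) × ℂ) × ℂ →L[ℂ] (Fin 4 → ℂ) × ℂ × ℂ) u :=
      (ContinuousLinearEquiv.prodAssoc ℂ (Fin 4 → ℂ) ℂ ℂ).hasFDerivAt
    have h2 := HasFDerivAt.comp (g := curveEq) u
      ((contDiff_curveEq (n := 1)).differentiable one_ne_zero (t₀, q₀)).hasFDerivAt h1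
    rw [show fderiv ℂ f u = _ from h2.fderiv]
    have h3 := fderiv_curveEq (t₀, q₀) 0 (0, 1)
    simp [cubicVariation_zero] at h3 ⊢
    rw [h3]
    simpa using hy
  refine ⟨fun z => (z.2, hcd.implicitFunction two_ne_zero hinv z), ?_, ?_, ?_, ?_⟩
  · exact contDiffAt_snd.prodMk (hcd.contDiffAt_implicitFunction two_ne_zero hinv)
  · exact Prod.ext rfl (hcd.implicitFunction_apply_self two_ne_zero hinv)
  · filter_upwards [hcd.eventually_apply_implicitFunction two_ne_zero hinv] with z hz
    exact ⟨(mem_E_iff (z := (z.1, z.2, _))).2 (hz.trans hfu), rfl⟩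
  · have hc : Filter.Tendsto (fun z : (Fin 4 → ℂ) × ℂ × ℂ => ((z.1, z.2.1), z.2.2)) (𝓝 (t₀, q₀))
        (𝓝 u) := Continuous.tendsto (by fun_prop) (t₀, q₀)
    filter_upwards [hc.eventually
      (hcd.eventually_apply_eq_iff_implicitFunction two_ne_zero hinv)] with z hz hzE
    exact Prod.ext rfl (hz.1 ((mem_E_iff.1 hzE).trans hfu.symm))

theorem exists_chart_snd {t₀ : Fin 4 → ℂ} {q₀ : ℂ × ℂ} (hq : q₀ ∈ E t₀)
    (hp : (cubic t₀).derivative.eval q₀.1 ≠ 0) :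
    ∃ Ψ, Chart t₀ q₀ (ContinuousLinearMap.snd ℂ ℂ ℂ) Ψ := by
  set f : ((Fin 4 → ℂ) × ℂ) × ℂ → ℂ := fun w => curveEq (w.1.1, w.2, w.1.2) with hf
  set u : ((Fin 4 → ℂ) × ℂ) × ℂ := ((t₀, q₀.2), q₀.1) with hu
  have hfu : f u = 0 := mem_E_iff.1 hq
  have hcd : ContDiffAt ℂ 2 f u := by
    have := (contDiff_curveEq (n := 2))
    fun_prop
  have hinv : (fderiv ℂ f u ∘L .inr ℂ _ _).IsInvertible := by
    refine isInvertible_of_apply_one_ne_zero ?_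
    have h1 := (hasFDerivAt_fst (𝕜 := ℂ) (p := u)).fst.prodMk
      ((hasFDerivAt_snd (𝕜 := ℂ) (p := u)).prodMk (hasFDerivAt_fst (𝕜 := ℂ) (p := u)).snd)
    have h2 := HasFDerivAt.comp (g := curveEq) u
      ((contDiff_curveEq (n := 1)).differentiable one_ne_zero (t₀, q₀)).hasFDerivAt h1
    rw [show fderiv ℂ f u = _ from h2.fderiv]
    have h3 := fderiv_curveEq (t₀, q₀) 0 (1, 0)
    simp [cubicVariation_zero] at h3 ⊢
    rw [h3]
    simpa using hp
  refine ⟨fun z => (hcd.implicitFunction two_ne_zero hinv z, z.2), ?_, ?_, ?_, ?_⟩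
  · exact (hcd.contDiffAt_implicitFunction two_ne_zero hinv).prodMk contDiffAt_snd
  · exact Prod.ext (hcd.implicitFunction_apply_self two_ne_zero hinv) rfl
  · filter_upwards [hcd.eventually_apply_implicitFunction two_ne_zero hinv] with z hz
    exact ⟨(mem_E_iff (z := (z.1, _, z.2))).2 (hz.trans hfu), rfl⟩
  · have hc : Filter.Tendsto (fun z : (Fin 4 → ℂ) × ℂ × ℂ => ((z.1, z.2.2), z.2.1)) (𝓝 (t₀, q₀))
        (𝓝 u) := Continuous.tendsto (by fun_prop) (t₀, q₀)
    filter_upwards [hc.eventually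
      (hcd.eventually_apply_eq_iff_implicitFunction two_ne_zero hinv)] with z hz hzE
    exact Prod.ext (hz.1 ((mem_E_iff.1 hzE).trans hfu.symm)) rfl

theorem exists_chart {t₀ : Fin 4 → ℂ} (ht : t₀ ∈ T) {q₀ : ℂ × ℂ} (hq : q₀ ∈ E t₀) :
    ∃ ℓ Ψ, Chart t₀ q₀ ℓ Ψ := by
  by_cases hy : q₀.2 = 0
  · exact ⟨_, exists_chart_snd hq (derivative_cubic_ne_zero ht hq hy)⟩
  · exact ⟨_, exists_chart_fst hq hy⟩

namespace Chart

variable {t₀ : Fin 4 → ℂ} {q₀ : ℂ × ℂ} {ℓ : ℂ × ℂ →L[ℂ] ℂ} {Ψ : (Fin 4 → ℂ) × ℂ → ℂ × ℂ}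

theorem tendsto (hc : Chart t₀ q₀ ℓ Ψ) :
    Filter.Tendsto (fun z => (z.1, Ψ z)) (𝓝 (t₀, ℓ q₀)) (𝓝 (t₀, q₀)) := by
  have h := (continuousAt_fst (p := (t₀, ℓ q₀))).prodMk hc.contDiffAt.continuousAt
  simpa only [ContinuousAt, hc.base] using h

/-- Near the base point, a chart is differentiable, and its derivative is tangent to the total
space. -/
theorem eventually_hasFDerivAt (hc : Chart t₀ q₀ ℓ Ψ) :
    ∀ᶠ z in 𝓝 (t₀, ℓ q₀), HasFDerivAt Ψ (fderiv ℂ Ψ z) z ∧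
      ∀ τ ν, IsTangent z.1 (Ψ z) τ (fderiv ℂ Ψ z (τ, ν)) ∧ ℓ (fderiv ℂ Ψ z (τ, ν)) = ν := by
  filter_upwards [hc.contDiffAt.eventually (by simp), hc.mem.eventually_nhds] with z hz hmem
  have hd : HasFDerivAt Ψ (fderiv ℂ Ψ z) z := (hz.differentiableAt two_ne_zero).hasFDerivAt
  refine ⟨hd, fun τ ν => ⟨?_, ?_⟩⟩
  · have h1 := HasFDerivAt.comp (g := curveEq) z
      ((contDiff_curveEq (n := 1)).differentiable one_ne_zero (z.1, Ψ z)).hasFDerivAt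
      ((hasFDerivAt_fst (𝕜 := ℂ) (p := z)).prodMk hd)
    have h2 : HasFDerivAt (fun w => curveEq (w.1, Ψ w))
        (0 : (Fin 4 → ℂ) × ℂ →L[ℂ] ℂ) z :=
      (hasFDerivAt_const (0 : ℂ) z).congr_of_eventuallyEq
        (hmem.mono fun w hw => (mem_E_iff (z := (w.1, Ψ w))).1 hw.1)
    have h3 := congrArg (fun L => L (τ, ν)) (h1.unique h2)
    exact (isTangent_iff (z := (z.1, Ψ z))).2 (by simpa using h3)
  · have h1 : HasFDerivAt (fun w => ℓ (Ψ w)) _ z := ℓ.hasFDerivAt.comp z hd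
    have h2 : HasFDerivAt (fun w => ℓ (Ψ w)) _ z :=
      (hasFDerivAt_snd (𝕜 := ℂ) (p := z)).congr_of_eventuallyEq (hmem.mono fun w hw => hw.2)
    have h3 := congrArg (fun L => L (τ, ν)) (h1.unique h2)
    simpa using h3

end Chart

/-! ### Local primitives satisfying the Gauss–Manin equation -/

/-- The contraction of `ω_j` with a tangent vector `(τ, v)` of the total space, plus the exact part
of the derivative of `ω_j` in the direction `τ`. -/
noncomputable def boundaryTerm (t : Fin 4 → ℂ) (j : Fin 2) (q : ℂ × ℂ) (τ : Fin 4 → ℂ)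
    (v : ℂ × ℂ) : ℂ :=
  open Classical in
  if q.2 ≠ 0 then
    ((∑ i, τ i * (exactPart t i j).eval q.1) / disc t + q.1 ^ (j : ℕ) * v.1) / q.2
  else 2 * q.1 ^ (j : ℕ) * v.2 / (cubic t).derivative.eval q.1

/-- Local primitives `F j` of the forms `ω_j` near the point `(t₀, q₀)` of the total space, whose
derivatives at `t₀` satisfy the Gauss-Manin equation up to a term that only depends on the point
of the curve. -/
structure LocalPeriod (t₀ : Fin 4 → ℂ) (q₀ : ℂ × ℂ)
    (F : Fin 2 → (Fin 4 → ℂ) × ℂ × ℂ → ℂ) : Prop where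
  vertical : ∀ᶠ z in 𝓝 (t₀, q₀), z.2 ∈ E z.1 → ∀ j, ∃ F' : ℂ × ℂ →L[ℂ] ℂ,
    HasFDerivAt (fun q => F j (z.1, q)) F' z.2 ∧
      ∀ v, IsTangent z.1 z.2 0 v → F' v = ω z.1 j z.2 v
  total : ∀ᶠ q in 𝓝 q₀, q ∈ E t₀ → ∀ j, ∃ F' : (Fin 4 → ℂ) × ℂ × ℂ →L[ℂ] ℂ,
    HasFDerivAt (F j) F' (t₀, q) ∧ ∀ τ v, IsTangent t₀ q τ v →
      F' (τ, v) = ∑ k, connA t₀ j k τ * F k (t₀, q) + boundaryTerm t₀ j q τ v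

/-- In the coordinate u = ℓ the form is G_j du, and `hh` is the Gauss–Manin equation at constant u:
∂_τ G_j du = ∑ A_jk G_k du + dh. Integrating from u₀ gives the equation for the primitives up to the
value of h at q₀. -/
theorem LocalPeriod.of_chart {t₀ : Fin 4 → ℂ} {q₀ : ℂ × ℂ} {ℓ : ℂ × ℂ →L[ℂ] ℂ}
    {Ψ : (Fin 4 → ℂ) × ℂ → ℂ × ℂ} (hc : Chart t₀ q₀ ℓ Ψ)
    {G : Fin 2 → (Fin 4 → ℂ) × ℂ × ℂ → ℂ} (hG : ∀ j, ContDiffAt ℂ 2 (G j) (t₀, q₀))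
    {h : Fin 2 → Fin 4 → ℂ × ℂ → ℂ}
    (hω : ∀ᶠ z in 𝓝 (t₀, q₀), z.2 ∈ E z.1 → ∀ j v, IsTangent z.1 z.2 0 v →
      ω z.1 j z.2 v = G j z * ℓ v)
    (hb : ∀ᶠ q in 𝓝 q₀, q ∈ E t₀ → ∀ j τ v, IsTangent t₀ q τ v →
      boundaryTerm t₀ j q τ v = ∑ i, τ i * h j i q + G j (t₀, q) * ℓ v)
    (hh : ∀ᶠ q in 𝓝 q₀, q ∈ E t₀ → ∀ j τ, ∃ h' : ℂ × ℂ →L[ℂ] ℂ,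
      HasFDerivAt (fun q => ∑ i, τ i * h j i q) h' q ∧ ∀ v w, IsTangent t₀ q τ v → ℓ v = 0 →
        IsTangent t₀ q 0 w → ℓ w = 1 →
        h' w = fderiv ℂ (G j) (t₀, q) (τ, v) - ∑ k, connA t₀ j k τ * G k (t₀, q)) :
    ∃ F, LocalPeriod t₀ q₀ F := by
  set u₀ := ℓ q₀ with hu₀
  have hbase : Ψ (t₀, u₀) = q₀ := hc.base
  set g : Fin 2 → (Fin 4 → ℂ) × ℂ → ℂ := fun j z => G j (z.1, Ψ z) with hg
  have hgc : ∀ j, ContDiffAt ℂ 2 (g j) (t₀, u₀) := fun j => by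
    have h1 : ContDiffAt ℂ 2 (fun z : (Fin 4 → ℂ) × ℂ => (z.1, Ψ z)) (t₀, u₀) :=
      contDiffAt_fst.prodMk hc.contDiffAt
    refine ContDiffAt.comp (g := G j) _ ?_ h1
    simpa only [hbase] using hG j
  have hline : Filter.Tendsto (fun z : (Fin 4 → ℂ) × ℂ => Ψ z) (𝓝 (t₀, u₀)) (𝓝 q₀) := by
    simpa only [ContinuousAt, ← hu₀, hbase] using hc.contDiffAt.continuousAt
  have hGd : ∀ᶠ z in 𝓝 (t₀, q₀), ∀ j, DifferentiableAt ℂ (G j) z := by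
    rw [Filter.eventually_all]
    exact fun j => ((hG j).eventually (by simp)).mono fun z hz => hz.differentiableAt two_ne_zero
  obtain ⟨ρ, hρ, hball⟩ := Metric.eventually_nhds_iff_ball.1
    ((Filter.eventually_all.2 fun j => (hgc j).eventually (by simp)).and
      (hc.eventually_hasFDerivAt.and (hc.mem.and ((hline.eventually hh).and
        (hc.tendsto.eventually hGd)))))
  have hgC : ∀ j, ContDiffOn ℂ 2 (g j) (Metric.ball (t₀, u₀) ρ) := fun j z hz =>
    ((hball z hz).1 j).contDiffWithinAt
  have hgC1 : ∀ j, ContDiffOn ℂ 1 (g j) (Metric.ball (t₀, u₀) ρ) := fun j =>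
    (hgC j).of_le one_le_two
  have hgτ : ∀ j τ, ContDiffOn ℂ 1 (fun w => fderiv ℂ (g j) w (τ, 0))
      (Metric.ball (t₀, u₀) ρ) := fun j τ =>
    ((hgC j).fderiv_of_isOpen Metric.isOpen_ball (by norm_num)).clm_apply contDiffOn_const
  have hzero : ∀ (f : (Fin 4 → ℂ) × ℂ → ℂ) (z : (Fin 4 → ℂ) × ℂ),
      radialPrimitive u₀ (fun w => fderiv ℂ f w (0, 0)) z = 0 := fun f z => by
    simp [radialPrimitive, show ((0, 0) : (Fin 4 → ℂ) × ℂ) = 0 from rfl]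
  -- The radial primitive vanishes at u₀ for all t. The added linear function of t vanishes at t₀
  -- and supplies the missing h(q₀) in the parameter derivative.
  set F : Fin 2 → (Fin 4 → ℂ) × ℂ × ℂ → ℂ := fun j z =>
    radialPrimitive u₀ (g j) (z.1, ℓ z.2) + ∑ i, h j i q₀ * (z.1 i - t₀ i) with hF
  have hproj : Filter.Tendsto (fun z : (Fin 4 → ℂ) × ℂ × ℂ => (z.1, ℓ z.2)) (𝓝 (t₀, q₀))
      (𝓝 (t₀, u₀)) := Continuous.tendsto (by fun_prop) (t₀, q₀)
  have hslice : Filter.Tendsto (fun q : ℂ × ℂ => (t₀, q)) (𝓝 q₀) (𝓝 (t₀, q₀)) :=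
    Continuous.tendsto (by fun_prop) q₀
  have hnear := hproj.eventually (Metric.ball_mem_nhds (t₀, u₀) hρ)
  refine ⟨F, ⟨?_, ?_⟩⟩
  · filter_upwards [hnear, hω, hc.inv] with z hz hωz hinv hzE j
    obtain ⟨L, hL, hLv⟩ := hasFDerivAt_radialPrimitive (hgC1 j) hz
    have hm : HasFDerivAt (fun q : ℂ × ℂ => (z.1, ℓ q)) ((0 : ℂ × ℂ →L[ℂ] Fin 4 → ℂ).prod ℓ) z.2 :=
      (hasFDerivAt_const _ _).prodMk ℓ.hasFDerivAt
    have hd := (HasFDerivAt.comp z.2 hL hm).add_const (∑ i, h j i q₀ * (z.1 i - t₀ i))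
    refine ⟨_, hd, fun v hv => ?_⟩
    rw [hωz hzE j v hv]
    have h1 := hLv 0 (ℓ v)
    rw [hzero, zero_add] at h1
    simpa [hg, hinv hzE] using h1
  · filter_upwards [hslice.eventually hnear, hb, hslice.eventually hc.inv] with q hq hbq hinv hqE j
    obtain ⟨L, hL, hLv⟩ := hasFDerivAt_radialPrimitive (hgC1 j) hq
    have hm : HasFDerivAt (fun z : (Fin 4 → ℂ) × ℂ × ℂ => (z.1, ℓ z.2))
        ((ContinuousLinearMap.fst ℂ _ _).prod (ℓ.comp (ContinuousLinearMap.snd ℂ _ _))) (t₀, q) :=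
      hasFDerivAt_fst.prodMk (ℓ.hasFDerivAt.comp _ hasFDerivAt_snd)
    have ht : HasFDerivAt (fun z : (Fin 4 → ℂ) × ℂ × ℂ => ∑ i, h j i q₀ * (z.1 i - t₀ i))
        (∑ i, h j i q₀ • (ContinuousLinearMap.proj (R := ℂ) i).comp
          (ContinuousLinearMap.fst ℂ (Fin 4 → ℂ) (ℂ × ℂ))) (t₀, q) := by
      refine HasFDerivAt.fun_sum fun i _ => HasFDerivAt.const_mul ?_ _
      exact (((ContinuousLinearMap.proj (R := ℂ) i).comp
          (ContinuousLinearMap.fst ℂ (Fin 4 → ℂ) (ℂ × ℂ))).hasFDerivAt).sub_const _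
    have hd := (HasFDerivAt.comp (t₀, q) hL hm).add ht
    refine ⟨_, hd, fun τ v hv => ?_⟩
    -- N is the defect in the integrated equation; `hh` makes its derivative zero, so it keeps its
    -- value -h(q₀) from u₀.
    set N : ℂ → ℂ := fun u => radialPrimitive u₀ (fun w => fderiv ℂ (g j) w (τ, 0)) (t₀, u) -
      ∑ k, connA t₀ j k τ * radialPrimitive u₀ (g k) (t₀, u) - ∑ i, τ i * h j i (Ψ (t₀, u))
      with hN
    have hNd : ∀ u ∈ Metric.ball u₀ ρ, HasDerivAt N 0 u := fun u hu => by
      have hmem : (t₀, u) ∈ Metric.ball (t₀, u₀) ρ := by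
        rw [← ball_prod_same]; exact ⟨Metric.mem_ball_self hρ, hu⟩
      obtain ⟨-, ⟨hΨ, hΨt⟩, ⟨hE, -⟩, hhq, hGq⟩ := hball _ hmem
      obtain ⟨h', hh', hval⟩ := hhq hE j τ
      have hin : HasDerivAt (fun u : ℂ => (t₀, u)) (0, 1) u :=
        (hasDerivAt_const u t₀).prodMk (hasDerivAt_id u)
      have hprim : ∀ f : (Fin 4 → ℂ) × ℂ → ℂ, ContDiffOn ℂ 1 f (Metric.ball (t₀, u₀) ρ) →
          HasDerivAt (fun u => radialPrimitive u₀ f (t₀, u)) (f (t₀, u)) u := fun f hf => by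
        obtain ⟨L, hL, hLv⟩ := hasFDerivAt_radialPrimitive hf hmem
        have h1 := hL.comp_hasDerivAt u hin
        rw [hLv, hzero, zero_add, mul_one] at h1
        exact h1
      have hd1 := hprim _ (hgτ j τ)
      have hd2 := HasDerivAt.fun_sum (u := Finset.univ) fun k _ =>
        (hprim _ (hgC1 k)).const_mul (connA t₀ j k τ)
      have hd3 : HasDerivAt (fun u => ∑ i, τ i * h j i (Ψ (t₀, u)))
          (h' (fderiv ℂ Ψ (t₀, u) (0, 1))) u :=
        HasFDerivAt.comp_hasDerivAt (f := fun u => Ψ (t₀, u)) u hh' (hΨ.comp_hasDerivAt u hin)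
      have hgd : fderiv ℂ (g j) (t₀, u) (τ, 0) =
          fderiv ℂ (G j) (t₀, Ψ (t₀, u)) (τ, fderiv ℂ Ψ (t₀, u) (τ, 0)) := by
        have h1 := HasFDerivAt.comp (g := G j) (t₀, u) (hGq j).hasFDerivAt
          ((hasFDerivAt_fst (𝕜 := ℂ) (p := (t₀, u))).prodMk hΨ)
        rw [show fderiv ℂ (g j) (t₀, u) = _ from h1.fderiv]
        rfl
      refine ((hd1.sub hd2).sub hd3).congr_deriv ?_
      rw [hval _ _ (hΨt τ 0).1 (hΨt τ 0).2 (hΨt 0 1).1 (hΨt 0 1).2, hgd]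
      simp [hg]
    have hconst : N (ℓ q) = N u₀ := by
      refine Metric.isOpen_ball.is_const_of_deriv_eq_zero (convex_ball u₀ ρ).isPreconnected
        (fun u hu => (hNd u hu).differentiableAt.differentiableWithinAt)
        (fun u hu => (hNd u hu).deriv) ?_ (Metric.mem_ball_self hρ)
      have h1 : (t₀, ℓ q) ∈ Metric.ball (t₀, u₀) ρ := hq
      rw [← ball_prod_same] at h1
      exact h1.2
    have hΨq : Ψ (t₀, ℓ q) = q := hinv hqE
    simp only [hN, radialPrimitive_self, mul_zero, Finset.sum_const_zero, hbase, hΨq] at hconst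
    rw [hbq hqE j τ v hv]
    have hL' := hLv τ (ℓ v)
    simp only [hF, hg, hΨq, sub_self, mul_zero, Finset.sum_const_zero, add_zero] at hL' ⊢
    simp only [add_apply, ContinuousLinearMap.comp_apply,
      ContinuousLinearMap.prod_apply, ContinuousLinearMap.coe_fst', ContinuousLinearMap.coe_snd',
      sum_apply, smul_apply,
      ContinuousLinearMap.proj_apply, smul_eq_mul, hL']
    have hcomm : ∑ i, h j i q₀ * τ i = ∑ i, τ i * h j i q₀ := by simp only [mul_comm]
    rw [hcomm]
    linear_combination hconst

/-- The polynomial `r` for which `d (r / y)` is the exact part of the derivative of `x ^ j dx / y`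
in the parameter direction `τ` at constant `x`. -/
noncomputable def exactVariation (t : Fin 4 → ℂ) (j : Fin 2) (τ : Fin 4 → ℂ) : ℂ[X] :=
  ∑ i, C (τ i / disc t) * exactPart t i j

/-- The polynomial `s` for which `s dx / y` is the value of the connection at `ω_j` and `τ`. -/
noncomputable def connVariation (t : Fin 4 → ℂ) (j : Fin 2) (τ : Fin 4 → ℂ) : ℂ[X] :=
  ∑ k : Fin 2, C (connA t j k τ) * X ^ (k : ℕ)

theorem connA_apply (t : Fin 4 → ℂ) (j k : Fin 2) (τ : Fin 4 → ℂ) :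
    connA t j k τ = ∑ i, τ i / disc t * matA t i j k := by
  simp only [connA, Matrix.of_apply, smul_apply, sum_apply, ContinuousLinearMap.proj_apply,
    smul_eq_mul, Finset.mul_sum]
  exact Finset.sum_congr rfl fun i _ => by ring

theorem eval_connVariation (t : Fin 4 → ℂ) (j : Fin 2) (τ : Fin 4 → ℂ) (x : ℂ) :
    (connVariation t j τ).eval x = ∑ k : Fin 2, connA t j k τ * x ^ (k : ℕ) := by
  simp [connVariation]

theorem cubicVariation_reduction {t : Fin 4 → ℂ} (ht : t ∈ T) (j : Fin 2) (τ : Fin 4 → ℂ) :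
    -(X ^ (j : ℕ) * cubicVariation t τ) =
      2 * (connVariation t j τ + derivative (exactVariation t j τ)) * cubic t
        - exactVariation t j τ * derivative (cubic t) := by
  have hd : disc t ≠ 0 := ht
  have h1 : ∀ i, C (τ i) * (X ^ (j : ℕ) * cubicPartial t i) = C (τ i / disc t) *
      (C (disc t) * X ^ (j : ℕ) * cubicPartial t i) := fun i => by
    rw [← mul_assoc, ← mul_assoc, ← mul_assoc, ← C_mul, div_mul_cancel₀ _ hd]
  have h2 : X ^ (j : ℕ) * cubicVariation t τ =
      ∑ i, C (τ i / disc t) * (C (disc t) * X ^ (j : ℕ) * cubicPartial t i) := by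
    rw [cubicVariation, Finset.mul_sum]
    exact Finset.sum_congr rfl fun i _ => by rw [← h1]; ring
  have h3 : connVariation t j τ =
      ∑ i, C (τ i / disc t) * ∑ k : Fin 2, C (matA t i j k) * X ^ (k : ℕ) := by
    simp only [connVariation, connA_apply, Fin.sum_univ_four, Fin.sum_univ_two, map_add, map_mul]
    ring
  rw [h2, h3, exactVariation, derivative_sum, ← Finset.sum_neg_distrib, ← Finset.sum_add_distrib,
    Finset.mul_sum, Finset.sum_mul, Finset.sum_mul, ← Finset.sum_sub_distrib]
  refine Finset.sum_congr rfl fun i _ => ?_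
  rw [derivative_C_mul]
  linear_combination C (τ i / disc t) * cubicPartial_reduction t i j

theorem ω_apply_of_y_ne_zero {t : Fin 4 → ℂ} {q : ℂ × ℂ} (hy : q.2 ≠ 0) (j : Fin 2) (v : ℂ × ℂ) :
    ω t j q v = q.1 ^ (j : ℕ) * q.2⁻¹ * v.1 := by
  simp [ω, dxOverY, hy, mul_assoc]

/-- On vertical tangent vectors 2y dy = p' dx, so both branches of `dxOverY` agree wherever they
make sense. -/
theorem ω_apply_of_derivative_ne_zero {t : Fin 4 → ℂ} {q v : ℂ × ℂ}
    (hp : (cubic t).derivative.eval q.1 ≠ 0) (hv : IsTangent t q 0 v) (j : Fin 2) :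
    ω t j q v = 2 * q.1 ^ (j : ℕ) * ((cubic t).derivative.eval q.1)⁻¹ * v.2 := by
  rw [IsTangent, cubicVariation_zero, eval_zero, zero_add] at hv
  by_cases hy : q.2 = 0
  · simp [ω, dxOverY, hy]
    ring
  · simp [ω, dxOverY, hy]
    field_simp
    linear_combination -q.1 ^ (j : ℕ) * hv

theorem hasFDerivAt_eval_fst (p : ℂ[X]) (q : ℂ × ℂ) :
    HasFDerivAt (fun q : ℂ × ℂ => p.eval q.1)
      (p.derivative.eval q.1 • ContinuousLinearMap.fst ℂ ℂ ℂ) q :=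
  (p.hasDerivAt q.1).comp_hasFDerivAt q hasFDerivAt_fst

/-- In the coordinate x one has G_j = x^j/y and h = r/(Δy), and the required equation is the
reduction identity. -/
theorem exists_localPeriod_of_y_ne_zero {t₀ : Fin 4 → ℂ} (ht : t₀ ∈ T) {q₀ : ℂ × ℂ}
    (hq₀ : q₀ ∈ E t₀) (hy : q₀.2 ≠ 0) : ∃ F, LocalPeriod t₀ q₀ F := by
  obtain ⟨Ψ, hc⟩ := exists_chart_fst hq₀ hy
  have hy' : ∀ᶠ q : ℂ × ℂ in 𝓝 q₀, q.2 ≠ 0 := continuousAt_snd.eventually_ne hy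
  have hsum : ∀ (j : Fin 2) (τ : Fin 4 → ℂ) (q : ℂ × ℂ),
      ∑ i, τ i * ((exactPart t₀ i j).eval q.1 / disc t₀ / q.2) =
        (exactVariation t₀ j τ).eval q.1 * q.2⁻¹ := fun j τ q => by
    simp only [exactVariation, eval_finsetSum, eval_mul, eval_C, Finset.sum_mul]
    exact Finset.sum_congr rfl fun i _ => by ring
  refine LocalPeriod.of_chart hc (G := fun j z => z.2.1 ^ (j : ℕ) * z.2.2⁻¹)
    (h := fun j i q => (exactPart t₀ i j).eval q.1 / disc t₀ / q.2) (fun j => ?_) ?_ ?_ ?_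
  · exact ContDiffAt.mul (by fun_prop) (ContDiffAt.inv (by fun_prop) hy)
  · filter_upwards [(continuousAt_snd.comp continuousAt_snd).eventually_ne hy] with z hz _ j v _
    exact ω_apply_of_y_ne_zero hz j v
  · filter_upwards [hy'] with q hq _ j τ v _
    rw [hsum, boundaryTerm, if_pos hq]
    simp only [exactVariation, eval_finsetSum, eval_mul, eval_C, Finset.sum_div]
    simp only [ContinuousLinearMap.coe_fst', add_div, Finset.sum_div, Finset.sum_mul]
    congr 1
    · exact Finset.sum_congr rfl fun i _ => by ring
    · ring
  · filter_upwards [hy'] with q hq hqE j τ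
    simp only [hsum]
    have hinv : ∀ {A : Type} [NormedAddCommGroup A] [NormedSpace ℂ A] (ℓ : A →L[ℂ] ℂ) (a : A),
        ℓ a ≠ 0 → HasFDerivAt (fun b => (ℓ b)⁻¹) (-(ℓ a ^ 2)⁻¹ • ℓ) a := fun ℓ a ha =>
      (hasDerivAt_inv ha).comp_hasFDerivAt a ℓ.hasFDerivAt
    have h1 := (hasFDerivAt_eval_fst (exactVariation t₀ j τ) q).mul
      (hinv (ContinuousLinearMap.snd ℂ ℂ ℂ) q hq)
    refine ⟨_, h1, fun v w hv hv0 hw hw1 => ?_⟩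
    have hx : HasFDerivAt (fun z : (Fin 4 → ℂ) × ℂ × ℂ => z.2.1 ^ (j : ℕ)) _ (t₀, q) :=
      ((hasFDerivAt_fst (𝕜 := ℂ) (p := q)).comp (t₀, q)
        (hasFDerivAt_snd (𝕜 := ℂ) (p := (t₀, q)))).pow (j : ℕ)
    have h2 := hx.mul (hinv ((ContinuousLinearMap.snd ℂ ℂ ℂ).comp
      (ContinuousLinearMap.snd ℂ (Fin 4 → ℂ) (ℂ × ℂ))) (t₀, q) hq)
    rw [show fderiv ℂ (fun z : (Fin 4 → ℂ) × ℂ × ℂ => z.2.1 ^ (j : ℕ) * z.2.2⁻¹) (t₀, q) = _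
      from h2.fderiv]
    have hred := congrArg (eval q.1) (cubicVariation_reduction ht j τ)
    simp only [eval_neg, eval_mul, eval_pow, eval_X, eval_sub, eval_add, eval_ofNat,
      eval_connVariation] at hred
    rw [← show q.2 ^ 2 = _ from hqE] at hred
    have hS : ∑ k : Fin 2, connA t₀ j k τ * (q.1 ^ (k : ℕ) * q.2⁻¹) =
      (∑ k : Fin 2, connA t₀ j k τ * q.1 ^ (k : ℕ)) * q.2⁻¹ := by
      rw [Finset.sum_mul]
      exact Finset.sum_congr rfl fun i _ => by ring
    simp only [ContinuousLinearMap.coe_fst'] at hv0 hw1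
    rw [IsTangent, hv0, mul_zero, add_zero] at hv
    rw [IsTangent, hw1, cubicVariation_zero, eval_zero, zero_add, mul_one] at hw
    rw [hS]
    generalize ∑ k : Fin 2, connA t₀ j k τ * q.1 ^ (k : ℕ) = S at hred
    rw [← hv, ← hw] at hred
    have hred' : -(q.1 ^ (j : ℕ) * v.2) =
        (S + (exactVariation t₀ j τ).derivative.eval q.1) * q.2
          - (exactVariation t₀ j τ).eval q.1 * w.2 :=
      mul_left_cancel₀ (mul_ne_zero two_ne_zero hq) (by linear_combination hred)
    simp [hv0, hw1]
    field_simp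
    linear_combination -hred'

theorem exists_hasFDerivAt_derivative_cubic (z : (Fin 4 → ℂ) × ℂ × ℂ) :
    ∃ L : (Fin 4 → ℂ) × ℂ × ℂ →L[ℂ] ℂ,
      HasFDerivAt (fun z : (Fin 4 → ℂ) × ℂ × ℂ => (cubic z.1).derivative.eval z.2.1) L z ∧
        ∀ τ v, L (τ, v) = (cubicVariation z.1 τ).derivative.eval z.2.1
          + (cubic z.1).derivative.derivative.eval z.2.1 * v.1 := by
  have ht : ∀ i, HasFDerivAt (fun z : (Fin 4 → ℂ) × ℂ × ℂ => z.1 i)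
      ((ContinuousLinearMap.proj (R := ℂ) i).comp (ContinuousLinearMap.fst ℂ _ _)) z := fun i =>
    ((ContinuousLinearMap.proj (R := ℂ) i).comp
      (ContinuousLinearMap.fst ℂ (Fin 4 → ℂ) (ℂ × ℂ))).hasFDerivAt
  have hx : HasFDerivAt (fun z : (Fin 4 → ℂ) × ℂ × ℂ => z.2.1)
      ((ContinuousLinearMap.fst ℂ ℂ ℂ).comp (ContinuousLinearMap.snd ℂ _ _)) z :=
    ((ContinuousLinearMap.fst ℂ ℂ ℂ).comp
      (ContinuousLinearMap.snd ℂ (Fin 4 → ℂ) (ℂ × ℂ))).hasFDerivAt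
  have h := (((ht 0).const_mul 12).mul ((hx.sub (ht 1)).pow 2)).sub (ht 2)
  refine ⟨_, h.congr_of_eventuallyEq (.of_forall fun w => eval_derivative_cubic _ _),
    fun τ v => ?_⟩
  have h2 : (cubic z.1).derivative.derivative.eval z.2.1 = 24 * z.1 0 * (z.2.1 - z.1 1) := by
    simp [derivative_cubic, derivative_pow]
    ring
  rw [eval_derivative_cubicVariation, h2]
  simp
  ring

/-- In the coordinate y one has G_j = 2x^j/p'. Although r/(Δy) may have a pole at y = 0, the
boundary term does not: with R = r/Δ, W = s + R' (s dx/y being the connection value) and Q the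
variation of p, the relations 2y v₂ = Q + p' v₁ and -x^j Q = 2Wy² - Rp' give (R + x^j v₁)/y = (2yW +
2x^j v₂)/p'. Hence h = 2yW/p'. -/
theorem exists_localPeriod_of_derivative_ne_zero {t₀ : Fin 4 → ℂ} (ht : t₀ ∈ T) {q₀ : ℂ × ℂ}
    (hq₀ : q₀ ∈ E t₀) (hp : (cubic t₀).derivative.eval q₀.1 ≠ 0) : ∃ F, LocalPeriod t₀ q₀ F := by
  obtain ⟨Ψ, hc⟩ := exists_chart_snd hq₀ hp
  have hcd : ContDiff ℂ 2
      (fun z : (Fin 4 → ℂ) × ℂ × ℂ => (cubic z.1).derivative.eval z.2.1) := by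
    simp only [eval_derivative_cubic]
    fun_prop
  have hp' : ∀ᶠ z : (Fin 4 → ℂ) × ℂ × ℂ in 𝓝 (t₀, q₀), (cubic z.1).derivative.eval z.2.1 ≠ 0 :=
    (hcd.continuous.continuousAt (x := (t₀, q₀))).eventually_ne hp
  have hp'' : ∀ᶠ q : ℂ × ℂ in 𝓝 q₀, (cubic t₀).derivative.eval q.1 ≠ 0 :=
    ((by fun_prop : Continuous fun q : ℂ × ℂ => (t₀, q)).tendsto q₀).eventually hp'
  have hinv : ∀ {A : Type} [NormedAddCommGroup A] [NormedSpace ℂ A] {f : A → ℂ} {f' : A →L[ℂ] ℂ}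
      {a : A}, HasFDerivAt f f' a → f a ≠ 0 →
      HasFDerivAt (fun b => (f b)⁻¹) (-(f a ^ 2)⁻¹ • f') a := fun hf ha =>
    (hasDerivAt_inv ha).comp_hasFDerivAt _ hf
  set W : Fin 2 → (Fin 4 → ℂ) → ℂ[X] := fun j τ =>
    connVariation t₀ j τ + derivative (exactVariation t₀ j τ) with hW
  have hsum : ∀ (j : Fin 2) (τ : Fin 4 → ℂ) (q : ℂ × ℂ),
      ∑ i, τ i * (2 * q.2 * ((C (1 / disc t₀) * (∑ k : Fin 2, C (matA t₀ i j k) * X ^ (k : ℕ) +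
        derivative (exactPart t₀ i j))).eval q.1 * ((cubic t₀).derivative.eval q.1)⁻¹)) =
        2 * q.2 * ((W j τ).eval q.1 * ((cubic t₀).derivative.eval q.1)⁻¹) := fun j τ q => by
    simp only [hW, connVariation, connA_apply, exactVariation, derivative_add, derivative_C_mul,
      eval_mul, eval_C, eval_add, eval_pow, eval_X, Fin.sum_univ_four,
      Fin.sum_univ_two]
    ring
  refine LocalPeriod.of_chart hc
    (G := fun j z => 2 * z.2.1 ^ (j : ℕ) * ((cubic z.1).derivative.eval z.2.1)⁻¹)
    (h := fun j i q => 2 * q.2 *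
      ((C (1 / disc t₀) * (∑ k : Fin 2, C (matA t₀ i j k) * X ^ (k : ℕ) +
        derivative (exactPart t₀ i j))).eval q.1 * ((cubic t₀).derivative.eval q.1)⁻¹))
    (fun j => ?_) ?_ ?_ ?_
  · exact ContDiffAt.mul (by fun_prop) (ContDiffAt.inv hcd.contDiffAt hp)
  · filter_upwards [hp'] with z hz _ j v hv
    exact ω_apply_of_derivative_ne_zero hz hv j
  · filter_upwards [hp''] with q hq hqE j τ v hv
    rw [hsum, boundaryTerm]
    have hred := congrArg (eval q.1) (cubicVariation_reduction ht j τ)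
    simp only [eval_neg, eval_mul, eval_pow, eval_X, eval_sub, eval_ofNat] at hred
    rw [← show q.2 ^ 2 = _ from hqE] at hred
    have hR : (∑ i, τ i * (exactPart t₀ i j).eval q.1) / disc t₀ =
        (exactVariation t₀ j τ).eval q.1 := by
      simp only [exactVariation, eval_finsetSum, eval_mul, eval_C, Finset.sum_div]
      exact Finset.sum_congr rfl fun i _ => by ring
    rw [IsTangent] at hv
    by_cases hy : q.2 = 0
    · simp [hy]
      ring
    · rw [if_pos hy, hR]
      simp only [ContinuousLinearMap.coe_snd']
      field_simp
      linear_combination hred - q.1 ^ (j : ℕ) * hv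
  · filter_upwards [hp''] with q hq hqE j τ
    simp only [hsum]
    have hy : HasFDerivAt (fun q : ℂ × ℂ => 2 * q.2) _ q :=
      (hasFDerivAt_snd (𝕜 := ℂ) (p := q)).const_mul 2
    have h1 := hy.mul ((hasFDerivAt_eval_fst (W j τ) q).mul
      (hinv (hasFDerivAt_eval_fst (derivative (cubic t₀)) q) hq))
    refine ⟨_, h1, fun v w hv hv0 hw hw1 => ?_⟩
    obtain ⟨L, hL, hLv⟩ := exists_hasFDerivAt_derivative_cubic (t₀, q)
    have hx : HasFDerivAt (fun z : (Fin 4 → ℂ) × ℂ × ℂ => z.2.1 ^ (j : ℕ)) _ (t₀, q) :=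
      ((hasFDerivAt_fst (𝕜 := ℂ) (p := q)).comp (t₀, q)
        (hasFDerivAt_snd (𝕜 := ℂ) (p := (t₀, q)))).pow (j : ℕ)
    have h2 := (hx.const_mul 2).mul (hinv hL hq)
    rw [show fderiv ℂ (fun z : (Fin 4 → ℂ) × ℂ × ℂ =>
      2 * z.2.1 ^ (j : ℕ) * ((cubic z.1).derivative.eval z.2.1)⁻¹) (t₀, q) = _ from h2.fderiv]
    have hred := congrArg (eval q.1) (cubicVariation_reduction ht j τ)
    -- The derivatives of W and Q enter through those of h and p', so the x-derivative of the
    -- reduction identity is needed too.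
    have hred' := congrArg (fun p => eval q.1 (derivative p)) (cubicVariation_reduction ht j τ)
    rw [show connVariation t₀ j τ + derivative (exactVariation t₀ j τ) = W j τ from rfl]
      at hred hred'
    simp only [derivative_neg, derivative_mul, derivative_sub, derivative_X_pow, derivative_ofNat,
      eval_neg, eval_mul, eval_pow, eval_X, eval_sub, eval_ofNat, eval_add, eval_C,
      zero_mul, zero_add] at hred hred'
    rw [← show q.2 ^ 2 = _ from hqE] at hred hred'
    have hS : ∑ k : Fin 2, connA t₀ j k τ * (2 * q.1 ^ (k : ℕ) *
        ((cubic t₀).derivative.eval q.1)⁻¹) =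
        2 * ((W j τ).eval q.1 - (exactVariation t₀ j τ).derivative.eval q.1) *
          ((cubic t₀).derivative.eval q.1)⁻¹ := by
      simp only [hW, eval_add, add_sub_cancel_right, eval_connVariation, Finset.sum_mul,
        Finset.mul_sum]
      exact Finset.sum_congr rfl fun i _ => by ring
    simp only [ContinuousLinearMap.coe_snd'] at hv0 hw1
    rw [IsTangent, hv0, mul_zero] at hv
    rw [IsTangent, hw1, cubicVariation_zero, eval_zero, zero_add, mul_one] at hw
    rw [hS]
    simp [hw1, hLv]
    generalize (W j τ).derivative.eval q.1 = W₁ at *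
    generalize (W j τ).eval q.1 = W₀ at *
    generalize (exactVariation t₀ j τ).derivative.eval q.1 = R₁ at *
    generalize (exactVariation t₀ j τ).eval q.1 = R₀ at *
    generalize (cubic t₀).derivative.derivative.eval q.1 = D₁ at *
    generalize (cubic t₀).derivative.eval q.1 = D₀ at *
    generalize (cubicVariation t₀ τ).derivative.eval q.1 = Q₁ at *
    generalize (cubicVariation t₀ τ).eval q.1 = Q₀ at *
    have hv1 : v.1 = -Q₀ / D₀ := by field_simp; linear_combination -hv
    have hw2 : w.1 = 2 * q.2 / D₀ := by field_simp; linear_combination -hw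
    rw [hv1, hw2]
    field_simp
    linear_combination D₁ * hred - D₀ * hred'

theorem exists_localPeriod {t₀ : Fin 4 → ℂ} (ht : t₀ ∈ T) {q₀ : ℂ × ℂ} (hq₀ : q₀ ∈ E t₀) :
    ∃ F, LocalPeriod t₀ q₀ F := by
  by_cases hy : q₀.2 = 0
  · exact exists_localPeriod_of_derivative_ne_zero ht hq₀ (derivative_cubic_ne_zero ht hq₀ hy)
  · exact exists_localPeriod_of_y_ne_zero ht hq₀ hy

namespace LocalPeriod

variable {t₀ : Fin 4 → ℂ} {q₀ : ℂ × ℂ} {F F₁ F₂ : Fin 2 → (Fin 4 → ℂ) × ℂ × ℂ → ℂ}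

theorem eventually (hF : LocalPeriod t₀ q₀ F) : ∀ᶠ q in 𝓝 q₀, LocalPeriod t₀ q F := by
  have h1 := (Continuous.tendsto (by fun_prop : Continuous fun q : ℂ × ℂ => (t₀, q)) q₀).eventually
    hF.vertical.eventually_nhds
  filter_upwards [h1, hF.total.eventually_nhds] with q hq1 hq2
  exact ⟨hq1, hq2⟩

/-- Horizontal functions of the parameters can be added to local primitives. -/
theorem add (hF : LocalPeriod t₀ q₀ F) {c : Fin 2 → (Fin 4 → ℂ) → ℂ}
    (hc : ∀ j, HasFDerivAt (c j) (∑ k, c k t₀ • connA t₀ j k) t₀) :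
    LocalPeriod t₀ q₀ fun j z => F j z + c j z.1 := by
  refine ⟨?_, ?_⟩
  · filter_upwards [hF.vertical] with z hz hzE j
    obtain ⟨F', hF', hv⟩ := hz hzE j
    exact ⟨F', hF'.add_const _, hv⟩
  · filter_upwards [hF.total] with q hq hqE j
    obtain ⟨F', hF', hv⟩ := hq hqE j
    have h1 := HasFDerivAt.comp (t₀, q) (hc j)
      (hasFDerivAt_fst (𝕜 := ℂ) (E := Fin 4 → ℂ) (F := ℂ × ℂ) (p := (t₀, q)))
    refine ⟨_, hF'.add h1, fun τ v hτ => ?_⟩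
    simp only [add_apply, hv τ v hτ, ContinuousLinearMap.comp_apply,
      ContinuousLinearMap.coe_fst', Fin.sum_univ_two, smul_apply, smul_eq_mul]
    ring

/-- Two systems of local primitives at the same point differ by horizontal functions of the
parameters. -/
theorem exists_sub_eq (ht : t₀ ∈ T) (hq₀ : q₀ ∈ E t₀) (h₁ : LocalPeriod t₀ q₀ F₁)
    (h₂ : LocalPeriod t₀ q₀ F₂) :
    ∃ c : Fin 2 → (Fin 4 → ℂ) → ℂ, (∀ j, HasFDerivAt (c j) (∑ k, c k t₀ • connA t₀ j k) t₀) ∧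
      ∀ᶠ z in 𝓝 (t₀, q₀), z.2 ∈ E z.1 → ∀ j, F₁ j z - F₂ j z = c j z.1 := by
  obtain ⟨ℓ, Ψ, hc⟩ := exists_chart ht hq₀
  -- The difference is read off at the point of coordinate ℓ q₀ on each curve. At t₀ the boundary
  -- terms cancel in its derivative; along a fixed curve both primitives have derivative ω_j, so it
  -- is constant there.
  refine ⟨fun j t => F₁ j (t, Ψ (t, ℓ q₀)) - F₂ j (t, Ψ (t, ℓ q₀)), fun j => ?_, ?_⟩
  · obtain ⟨L₁, hL₁, hv₁⟩ := h₁.total.self_of_nhds hq₀ j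
    obtain ⟨L₂, hL₂, hv₂⟩ := h₂.total.self_of_nhds hq₀ j
    obtain ⟨hΨ, hΨt⟩ := hc.eventually_hasFDerivAt.self_of_nhds
    have hs : HasFDerivAt (fun t => (t, Ψ (t, ℓ q₀))) ((ContinuousLinearMap.id ℂ _).prod
        ((fderiv ℂ Ψ (t₀, ℓ q₀)).comp (ContinuousLinearMap.inl ℂ (Fin 4 → ℂ) ℂ))) t₀ :=
      (hasFDerivAt_id t₀).prodMk (hΨ.comp t₀ (hasFDerivAt_prodMk_left t₀ (ℓ q₀)))
    rw [← hc.base] at hL₁ hL₂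
    refine ((hL₁.comp t₀ hs).sub (hL₂.comp t₀ hs)).congr_fderiv ?_
    ext1 τ
    have ht := (hΨt τ 0).1
    rw [hc.base] at ht
    simp [hv₁ _ _ ht, hv₂ _ _ ht, hc.base]
    ring
  · obtain ⟨ρ, hρ, hball⟩ := Metric.eventually_nhds_iff_ball.1
      ((hc.tendsto.eventually h₁.vertical).and ((hc.tendsto.eventually h₂.vertical).and
        (hc.eventually_hasFDerivAt.and hc.mem)))
    have hproj : Filter.Tendsto (fun z : (Fin 4 → ℂ) × ℂ × ℂ => (z.1, ℓ z.2)) (𝓝 (t₀, q₀))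
      (𝓝 (t₀, ℓ q₀)) := Continuous.tendsto (by fun_prop) (t₀, q₀)
    filter_upwards [hproj.eventually (Metric.ball_mem_nhds _ hρ), hc.inv] with z hz hinv hzE j
    replace hz : (z.1, ℓ z.2) ∈ Metric.ball t₀ ρ ×ˢ Metric.ball (ℓ q₀) ρ := by
      rw [ball_prod_same]; exact hz
    rw [← ball_prod_same] at hball
    set N : ℂ → ℂ := fun u => F₁ j (z.1, Ψ (z.1, u)) - F₂ j (z.1, Ψ (z.1, u)) with hN
    have hNd : ∀ u ∈ Metric.ball (ℓ q₀) ρ, HasDerivAt N 0 u := fun u hu => by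
      obtain ⟨hu₁, hu₂, ⟨hΨ, hΨt⟩, hE, -⟩ := hball (z.1, u) ⟨hz.1, hu⟩
      obtain ⟨L₁, hL₁, hv₁⟩ := hu₁ hE j
      obtain ⟨L₂, hL₂, hv₂⟩ := hu₂ hE j
      have hin : HasDerivAt (fun u : ℂ => (z.1, u)) (0, 1) u :=
        (hasDerivAt_const u z.1).prodMk (hasDerivAt_id u)
      have hs : HasDerivAt (fun u => Ψ (z.1, u)) _ u := hΨ.comp_hasDerivAt u hin
      refine ((hL₁.comp_hasDerivAt u hs).sub (hL₂.comp_hasDerivAt u hs)).congr_deriv ?_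
      rw [hv₁ _ (hΨt 0 1).1, hv₂ _ (hΨt 0 1).1, sub_self]
    have hconst : N (ℓ z.2) = N (ℓ q₀) :=
      Metric.isOpen_ball.is_const_of_deriv_eq_zero (convex_ball (ℓ q₀) ρ).isPreconnected
        (fun u hu => (hNd u hu).differentiableAt.differentiableWithinAt)
        (fun u hu => (hNd u hu).deriv) hz.2 (Metric.mem_ball_self hρ)
    simpa only [hN, hinv hzE] using hconst

end LocalPeriod

/-! ### Partial periods along a cycle -/

namespace CycleFamily

variable {U : Set (Fin 4 → ℂ)} (δ : CycleFamily U)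

/-- The cycles, as functions of a real parameter. -/
noncomputable def curve (t : Fin 4 → ℂ) (s : ℝ) : ℂ × ℂ := (δ.loop t).extend s

/-- The velocity of the cycles. -/
noncomputable def velocity (t : Fin 4 → ℂ) (s : ℝ) : ℂ × ℂ :=
  derivWithin (δ.curve t) (Set.Icc 0 1) s

theorem curve_mem_E {t : Fin 4 → ℂ} (ht : t ∈ U) (s : ℝ) : δ.curve t s ∈ E t :=
  δ.mem_E t ht (Set.projIcc 0 1 zero_le_one s)

theorem curve_one (t : Fin 4 → ℂ) : δ.curve t 1 = δ.curve t 0 := by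
  simp [curve]

theorem hasDerivWithinAt_curve {t : Fin 4 → ℂ} (ht : t ∈ U) {s : ℝ} (hs : s ∈ Set.Icc (0 : ℝ) 1) :
    HasDerivWithinAt (δ.curve t) (δ.velocity t s) (Set.Icc 0 1) s :=
  ((δ.contDiffOn t ht).differentiableOn one_ne_zero s hs).hasDerivWithinAt

theorem continuousOn_velocity {t : Fin 4 → ℂ} (ht : t ∈ U) :
    ContinuousOn (δ.velocity t) (Set.Icc 0 1) :=
  (δ.contDiffOn t ht).continuousOn_derivWithin (uniqueDiffOn_Icc zero_lt_one) le_rfl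

theorem isTangent_velocity {t : Fin 4 → ℂ} (ht : t ∈ U) {s : ℝ} (hs : s ∈ Set.Icc (0 : ℝ) 1) :
    IsTangent t (δ.curve t s) 0 (δ.velocity t s) := by
  rw [isTangent_iff (z := (t, δ.curve t s))]
  have h1 : HasFDerivAt curveEq (fderiv ℂ curveEq (t, δ.curve t s)) (t, δ.curve t s) :=
    ((contDiff_curveEq (n := 1)).differentiable one_ne_zero _).hasFDerivAt
  have h2 : HasDerivWithinAt (fun s => (t, δ.curve t s)) (0, δ.velocity t s) (Set.Icc 0 1) s :=
    (hasDerivWithinAt_const s _ t).prodMk (δ.hasDerivWithinAt_curve ht hs)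
  have h3 := (h1.restrictScalars ℝ).comp_hasDerivWithinAt s h2
  have h4 : HasDerivWithinAt (curveEq ∘ fun s => (t, δ.curve t s)) 0 (Set.Icc 0 1) s :=
    (hasDerivWithinAt_const s _ (0 : ℂ)).congr
      (fun s _ => (mem_E_iff (z := (t, δ.curve t s))).1 (δ.curve_mem_E ht s))
      ((mem_E_iff (z := (t, δ.curve t s))).1 (δ.curve_mem_E ht s))
  exact (uniqueDiffOn_Icc zero_lt_one s hs).eq_deriv _ h3 h4

theorem tendsto_curve (hU : IsOpen U) {t₀ : Fin 4 → ℂ} (ht₀ : t₀ ∈ U) (s : ℝ) :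
    Filter.Tendsto (fun z : (Fin 4 → ℂ) × ℝ => δ.curve z.1 z.2) (𝓝 t₀ ×ˢ 𝓝 s)
      (𝓝 (δ.curve t₀ s)) := by
  have h1 : ContinuousAt (fun q : (Fin 4 → ℂ) × unitInterval => δ.loop q.1 q.2)
      (t₀, Set.projIcc 0 1 zero_le_one s) :=
    δ.continuousOn.continuousAt ((hU.prod isOpen_univ).mem_nhds ⟨ht₀, Set.mem_univ _⟩)
  have h2 : ContinuousAt (fun z : (Fin 4 → ℂ) × ℝ => (z.1, Set.projIcc (0 : ℝ) 1 zero_le_one z.2))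
      (t₀, s) := Continuous.continuousAt (by fun_prop)
  rw [← nhds_prod_eq]
  exact ContinuousAt.comp (f := fun z : (Fin 4 → ℂ) × ℝ =>
    (z.1, Set.projIcc (0 : ℝ) 1 zero_le_one z.2)) h1 h2

/-- The definition of ω by cases is harmless along the curve: near a point with y = 0 the velocity
is tangent, and the formula with denominator p' holds throughout a neighbourhood. -/
theorem continuousOn_ω_velocity (hUT : U ⊆ T) {t : Fin 4 → ℂ} (ht : t ∈ U) (j : Fin 2) :
    ContinuousOn (fun s => ω t j (δ.curve t s) (δ.velocity t s)) (Set.Icc 0 1) := by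
  intro s hs
  have hc : ContinuousOn (δ.curve t) (Set.Icc 0 1) := (δ.contDiffOn t ht).continuousOn
  have hv := δ.continuousOn_velocity ht
  have hcs := hc s hs
  have hvs := hv s hs
  by_cases hy : (δ.curve t s).2 = 0
  · have hp : ContinuousWithinAt (fun s => (cubic t).derivative.eval (δ.curve t s).1)
        (Set.Icc 0 1) s := (Polynomial.continuous _).continuousAt.comp_continuousWithinAt hcs.fst
    have hp0 := derivative_cubic_ne_zero (hUT ht) (δ.curve_mem_E ht s) hy
    have h1 : ContinuousWithinAt (fun s => 2 * (δ.curve t s).1 ^ (j : ℕ) *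
        ((cubic t).derivative.eval (δ.curve t s).1)⁻¹ * (δ.velocity t s).2) (Set.Icc 0 1) s :=
      ((continuousWithinAt_const.mul (hcs.fst.pow _)).mul (hp.inv₀ hp0)).mul hvs.snd
    refine h1.congr_of_eventuallyEq ?_
      (ω_apply_of_derivative_ne_zero hp0 (δ.isTangent_velocity ht hs) j)
    filter_upwards [hp.eventually_ne hp0, self_mem_nhdsWithin] with s' hs' hm
    exact ω_apply_of_derivative_ne_zero hs' (δ.isTangent_velocity ht hm) j
  · have h1 : ContinuousWithinAt (fun s => (δ.curve t s).1 ^ (j : ℕ) *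
        (δ.curve t s).2⁻¹ * (δ.velocity t s).1) (Set.Icc 0 1) s :=
      ((hcs.fst.pow _).mul (hcs.snd.inv₀ hy)).mul hvs.fst
    refine h1.congr_of_eventuallyEq ?_ (ω_apply_of_y_ne_zero hy j _)
    filter_upwards [hcs.snd.eventually_ne hy] with s' hs'
    exact ω_apply_of_y_ne_zero hs' j _

/-- The integral of `ω_j` along the initial segment of the cycle. -/
noncomputable def partialPeriod (j : Fin 2) (t : Fin 4 → ℂ) (s : ℝ) : ℂ :=
  ∫ x in (0 : ℝ)..s, ω t j (δ.curve t x) (δ.velocity t x)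

theorem partialPeriod_zero (j : Fin 2) (t : Fin 4 → ℂ) : δ.partialPeriod j t 0 = 0 := by
  simp [partialPeriod]

theorem partialPeriod_one (j : Fin 2) (t : Fin 4 → ℂ) :
    δ.partialPeriod j t 1 = δ.period j t := by
  simp only [partialPeriod, period, curveIntegral_def, curveIntegralFun_def]
  rfl

theorem hasDerivWithinAt_partialPeriod (hUT : U ⊆ T) {t : Fin 4 → ℂ} (ht : t ∈ U) (j : Fin 2)
    {s : ℝ} (hs : s ∈ Set.Icc (0 : ℝ) 1) :
    HasDerivWithinAt (δ.partialPeriod j t) (ω t j (δ.curve t s) (δ.velocity t s))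
      (Set.Icc 0 1) s := by
  have hc := δ.continuousOn_ω_velocity hUT ht j
  have : Fact (s ∈ Set.Icc (0 : ℝ) 1) := ⟨hs⟩
  refine intervalIntegral.integral_hasDerivWithinAt_right (s := Set.Icc 0 1) (t := Set.Icc 0 1)
    (ContinuousOn.intervalIntegrable (hc.mono ?_)) ?_ (hc s hs)
  · rw [Set.uIcc_of_le hs.1]
    exact Set.Icc_subset_Icc_right hs.2
  · exact hc.stronglyMeasurableAtFilter_nhdsWithin measurableSet_Icc s

/-- Near a point of the cycle, the partial periods differ from local primitives by functions of
the parameters. -/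
theorem exists_partialPeriod_sub_const (hU : IsOpen U) (hUT : U ⊆ T) {t₀ : Fin 4 → ℂ}
    (ht₀ : t₀ ∈ U) {s : ℝ} {F : Fin 2 → (Fin 4 → ℂ) × ℂ × ℂ → ℂ}
    (hF : LocalPeriod t₀ (δ.curve t₀ s) F) :
    ∃ N ∈ 𝓝 t₀, ∃ M ∈ 𝓝 s, ∀ t ∈ N, ∀ s₁ ∈ M ∩ Set.Icc 0 1, ∀ s₂ ∈ M ∩ Set.Icc 0 1, ∀ j,
      δ.partialPeriod j t s₁ - F j (t, δ.curve t s₁) =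
        δ.partialPeriod j t s₂ - F j (t, δ.curve t s₂) := by
  have h1 : Filter.Tendsto (fun z : (Fin 4 → ℂ) × ℝ => (z.1, δ.curve z.1 z.2)) (𝓝 t₀ ×ˢ 𝓝 s)
      (𝓝 (t₀, δ.curve t₀ s)) := by
    rw [nhds_prod_eq]
    exact Filter.tendsto_fst.prodMk (δ.tendsto_curve hU ht₀ s)
  have h2 := (h1.eventually hF.vertical).and (Filter.tendsto_fst.eventually (hU.mem_nhds ht₀))
  obtain ⟨pa, hpa, pb, hpb, hab⟩ := Filter.eventually_prod_iff.1 h2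
  obtain ⟨ε, hε, hball⟩ := Metric.eventually_nhds_iff_ball.1 hpb
  refine ⟨{t | pa t}, hpa, Metric.ball s ε, Metric.ball_mem_nhds s hε,
    fun t ht s₁ hs₁ s₂ hs₂ j => ?_⟩
  have hd : ∀ x ∈ Metric.ball s ε ∩ Set.Icc 0 1,
      HasDerivWithinAt (fun x => δ.partialPeriod j t x - F j (t, δ.curve t x)) 0
        (Metric.ball s ε ∩ Set.Icc 0 1) x := fun x hx => by
    obtain ⟨hvert, htU⟩ := hab ht (hball x hx.1)
    obtain ⟨F', hF', hv⟩ := hvert (δ.curve_mem_E htU x) j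
    have h3 := (hF'.restrictScalars ℝ).comp_hasDerivWithinAt x (δ.hasDerivWithinAt_curve htU hx.2)
    have h4 := (δ.hasDerivWithinAt_partialPeriod hUT htU j hx.2).sub h3
    refine (h4.congr_deriv ?_).mono Set.inter_subset_right
    rw [sub_eq_zero]
    exact (hv _ (δ.isTangent_velocity htU hx.2)).symm
  have h5 := ((convex_ball s ε).inter (convex_Icc 0 1)).norm_image_sub_le_of_norm_hasDerivWithin_le
    (C := 0) hd (fun x _ => by simp) hs₂ hs₁
  rw [zero_mul, norm_le_zero_iff, sub_eq_zero] at h5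
  exact h5

end CycleFamily

/-! ### Continuation of primitives around the cycle -/

namespace CycleFamily

variable {U : Set (Fin 4 → ℂ)} (δ : CycleFamily U)

/-- Near the parameter `s`, the partial periods, shifted by the functions `b` of the parameters,
are given by local primitives. -/
def HasPrimitive (b : Fin 2 → (Fin 4 → ℂ) → ℂ) (t₀ : Fin 4 → ℂ) (s : ℝ) : Prop :=
  ∃ F, LocalPeriod t₀ (δ.curve t₀ s) F ∧ ∀ᶠ z in 𝓝 t₀ ×ˢ 𝓝[Set.Icc 0 1] s, ∀ j,
    b j z.1 + δ.partialPeriod j z.1 z.2 = F j (z.1, δ.curve z.1 z.2)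

theorem HasPrimitive.eventually {b : Fin 2 → (Fin 4 → ℂ) → ℂ} {t₀ : Fin 4 → ℂ} {s : ℝ}
    (hU : IsOpen U) (ht₀ : t₀ ∈ U) (h : δ.HasPrimitive b t₀ s) :
    ∀ᶠ s' in 𝓝[Set.Icc 0 1] s, δ.HasPrimitive b t₀ s' := by
  obtain ⟨F, hF, heq⟩ := h
  have h1 : Filter.Tendsto (δ.curve t₀) (𝓝 s) (𝓝 (δ.curve t₀ s)) :=
    (δ.tendsto_curve hU ht₀ s).comp (tendsto_const_nhds.prodMk Filter.tendsto_id)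
  obtain ⟨pa, hpa, pb, hpb, hab⟩ := Filter.eventually_prod_iff.1 heq
  filter_upwards [nhdsWithin_le_nhds (h1.eventually hF.eventually),
    eventually_eventually_nhdsWithin.2 hpb] with s' hs' hs''
  exact ⟨F, hs', Filter.eventually_prod_iff.2 ⟨pa, hpa, pb, hs'', hab⟩⟩

/-- A system G of primitives at s is also one at nearby s', where it differs from the given one by
horizontal functions c. Then G + c is the required system at s. -/
theorem HasPrimitive.of_eventually {b : Fin 2 → (Fin 4 → ℂ) → ℂ} {t₀ : Fin 4 → ℂ} {s : ℝ}
    (hU : IsOpen U) (hUT : U ⊆ T) (ht₀ : t₀ ∈ U) :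
    ∀ᶠ s' in 𝓝[Set.Icc 0 1] s, δ.HasPrimitive b t₀ s' → δ.HasPrimitive b t₀ s := by
  obtain ⟨G, hG⟩ := exists_localPeriod (hUT ht₀) (δ.curve_mem_E ht₀ s)
  obtain ⟨N, hN, M, hM, hNM⟩ := δ.exists_partialPeriod_sub_const hU hUT ht₀ hG
  have h1 : Filter.Tendsto (δ.curve t₀) (𝓝 s) (𝓝 (δ.curve t₀ s)) :=
    (δ.tendsto_curve hU ht₀ s).comp (tendsto_const_nhds.prodMk Filter.tendsto_id)
  filter_upwards [nhdsWithin_le_nhds (h1.eventually hG.eventually), nhdsWithin_le_nhds hM,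
    self_mem_nhdsWithin] with s' hGs' hs'M hs'I
  rintro ⟨F, hF, heq⟩
  obtain ⟨c, hc, hceq⟩ := hF.exists_sub_eq (hUT ht₀) (δ.curve_mem_E ht₀ s') hGs'
  refine ⟨_, hG.add hc, ?_⟩
  have h2 : Filter.Tendsto (fun t => (t, δ.curve t s')) (𝓝 t₀) (𝓝 (t₀, δ.curve t₀ s')) :=
    Filter.tendsto_id.prodMk_nhds ((δ.tendsto_curve hU ht₀ s').comp
      (Filter.tendsto_id.prodMk tendsto_const_nhds))
  have h3 : ∀ᶠ t in 𝓝 t₀, ∀ j, b j t + δ.partialPeriod j t s' = F j (t, δ.curve t s') := by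
    have h4 : Filter.Tendsto (fun t => (t, s')) (𝓝 t₀) (𝓝 t₀ ×ˢ 𝓝[Set.Icc 0 1] s') :=
      Filter.tendsto_id.prodMk (tendsto_const_nhdsWithin hs'I)
    exact h4.eventually heq
  have h5 : ∀ᶠ s'' in 𝓝[Set.Icc 0 1] s, s'' ∈ M ∩ Set.Icc 0 1 :=
    Filter.inter_mem (nhdsWithin_le_nhds hM) self_mem_nhdsWithin
  refine (((h2.eventually hceq).and (h3.and (Filter.Eventually.and hN (hU.mem_nhds ht₀)))).prod_mk
    h5).mono ?_
  rintro ⟨t, s''⟩ ⟨⟨hct, hbt, htN, htU⟩, hs''⟩ j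
  have h6 := hNM t htN s'' hs'' s' ⟨hs'M, hs'I⟩ j
  have h7 := hct (δ.curve_mem_E htU s') j
  have h8 := hbt j
  dsimp only at h6 h7 h8 ⊢
  linear_combination h6 + h7 + h8

/-- The Gauss-Manin equation for the periods along a continuous family of cycles. -/
theorem hasFDerivAt_period (hU : IsOpen U) (hUT : U ⊆ T) {t₀ : Fin 4 → ℂ} (ht₀ : t₀ ∈ U)
    (j : Fin 2) :
    HasFDerivAt (δ.period j) (∑ k, δ.period k t₀ • connA t₀ j k) t₀ := by
  have h0 : (0 : ℝ) ∈ Set.Icc (0 : ℝ) 1 := ⟨le_rfl, zero_le_one⟩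
  have h1 : (1 : ℝ) ∈ Set.Icc (0 : ℝ) 1 := ⟨zero_le_one, le_rfl⟩
  obtain ⟨F, hF⟩ := exists_localPeriod (hUT ht₀) (δ.curve_mem_E ht₀ 0)
  -- These initial values depend only continuously on t; they are subtracted again once the cycle
  -- has closed up.
  set b : Fin 2 → (Fin 4 → ℂ) → ℂ := fun j t => F j (t, δ.curve t 0) with hb
  have hstart : δ.HasPrimitive b t₀ 0 := by
    obtain ⟨N, hN, M, hM, hNM⟩ := δ.exists_partialPeriod_sub_const hU hUT ht₀ hF
    have h5 : ∀ᶠ s in 𝓝[Set.Icc 0 1] (0 : ℝ), s ∈ M ∩ Set.Icc 0 1 :=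
      Filter.inter_mem (nhdsWithin_le_nhds hM) self_mem_nhdsWithin
    refine ⟨F, hF, (Filter.Eventually.prod_mk hN h5).mono ?_⟩
    rintro ⟨t, s⟩ ⟨htN, hs⟩ j
    have h6 := hNM t htN s hs 0 ⟨mem_of_mem_nhds hM, h0⟩ j
    rw [δ.partialPeriod_zero] at h6
    simp only [hb]
    linear_combination h6
  have hend : δ.HasPrimitive b t₀ 1 := by
    -- The relation is transitive and holds in both directions between s and all nearby parameters,
    -- so it links 0 to 1.
    refine isPreconnected_Icc.induction₂' (fun s s' : ℝ => δ.HasPrimitive b t₀ s →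
      δ.HasPrimitive b t₀ s') (fun s _ => ?_) (fun _ _ _ _ _ _ h h' hx => h' (h hx)) h0 h1 hstart
    refine Filter.Eventually.and ?_ (HasPrimitive.of_eventually δ hU hUT ht₀)
    by_cases h : δ.HasPrimitive b t₀ s
    · exact (h.eventually δ hU ht₀).mono fun _ h _ => h
    · exact .of_forall fun _ h' => absurd h' h
  obtain ⟨F₁, hF₁, heq⟩ := hend
  -- The cycle is closed, so the final and initial primitives live at the same point and can be
  -- compared there.
  rw [δ.curve_one] at hF₁
  obtain ⟨c, hc, hceq⟩ := hF₁.exists_sub_eq (hUT ht₀) (δ.curve_mem_E ht₀ 0) hF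
  have h2 : Filter.Tendsto (fun t => (t, δ.curve t 0)) (𝓝 t₀) (𝓝 (t₀, δ.curve t₀ 0)) :=
    Filter.tendsto_id.prodMk_nhds ((δ.tendsto_curve hU ht₀ 0).comp
      (Filter.tendsto_id.prodMk tendsto_const_nhds))
  have h3 : Filter.Tendsto (fun t => (t, (1 : ℝ))) (𝓝 t₀) (𝓝 t₀ ×ˢ 𝓝[Set.Icc 0 1] 1) :=
    Filter.tendsto_id.prodMk (tendsto_const_nhdsWithin h1)
  have hper : ∀ᶠ t in 𝓝 t₀, ∀ j, δ.period j t = c j t := by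
    filter_upwards [h2.eventually hceq, h3.eventually heq, hU.mem_nhds ht₀] with t hct hbt htU j
    have h7 := hct (δ.curve_mem_E htU 0) j
    have h8 := hbt j
    rw [δ.partialPeriod_one, δ.curve_one] at h8
    simp only [hb] at h8
    linear_combination h7 + h8
  have hc' := (hc j).congr_of_eventuallyEq (hper.mono fun t ht => ht j)
  simp only [hper.self_of_nhds]
  exact hc'

end CycleFamily

end EllipticFamily

theorem proposition1 :
    -- `d pm = pm · Aᵗʳ`, entry by entry, for every local branch of the period matrix
    (∀ (U : Set (Fin 4 → ℂ)) (_ : IsOpen U) (_ : U ⊆ EllipticFamily.T)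
        (δ : Fin 2 → EllipticFamily.CycleFamily U) (t : Fin 4 → ℂ) (_ : t ∈ U) (a b : Fin 2),
      HasFDerivAt (fun s => EllipticFamily.pm δ s a b)
        (∑ c : Fin 2, EllipticFamily.pm δ t a c • (EllipticFamily.connA t).transpose c b) t) ∧
    -- `∇ ω = A ω` for the Gauss-Manin connection `∇` on the classes modulo exact forms
    (∀ (L : Type*) [Field L] [Algebra EllipticFamily.K L] (x y : L)
        (_ : EllipticFamily.IsFunctionField x y) (i : Fin 4) (D : Derivation ℤ L L)
        (_ : EllipticFamily.ExtendsPartial i D) (j : Fin 2),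
      (EllipticFamily.exactForms L).mkQ
          (EllipticFamily.lieDerivative D (x ^ (j : ℕ) / y) x) =
        ∑ k : Fin 2,
          (1 / EllipticFamily.disc EllipticFamily.tK *
              EllipticFamily.matA EllipticFamily.tK i j k) •
            (EllipticFamily.exactForms L).mkQ (EllipticFamily.ωK x y k)) := by
  refine ⟨fun U hU hUT δ t ht a b => ?_, fun L _ _ x y h i D hD j =>
    EllipticFamily.mkQ_lieDerivative h hD j⟩
  refine (((δ a).hasFDerivAt_period hU hUT ht b).const_mul _).congr_fderiv ?_
  simp only [EllipticFamily.pm, Matrix.of_apply, Matrix.transpose_apply, Finset.smul_sum, smul_smul]
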